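/- **Setting.** A *quantum system* with finite-dimensional complex Hilbert space $\mathcal H$ has sets of preparations $P$, measurements $M$ and transformations $T$, each mapped (in general many-to-one) onto the density operators $\rho$, the self-adjoint operators $A$ and the unitary operators $U$ on $\mathcal H$, respectively; we write $P_\rho, M_A, T_U$. Here $[a]_A$ is the projection onto the eigenspace of $A$ for the value $a$. An *ontic model* for the system consists of a measurable space $\Lambda$, a probability measure $\mu_P$ on $\Lambda$ for every preparation, a Markov kernel $p_M(\cdot\mid\lambda)$ from $\Lambda$ to the set of eigenvalues of $A$ for every measurement $M=M_A$ (the $\lambda$-probabilities), and a Markov kernel $\gamma_T$ from $\Lambda$ to $\Lambda$ for every transformation, such that for all $P_\rho, M_A, T_U$ and $a$ $$\int p_{M_A}(a|\lambda)\,d\mu_{P_\rho}(\lambda)=\mathrm{Tr}(\rho[a]_A),\qquad \iint p_{M_A}(a|\lambda)\,\gamma_{T_U}(d\lambda|\tilde\lambda)\,d\mu_{P_\rho}(\tilde\lambda)=\mathrm{Tr}(U\rho U^*[a]_A).$$ The model is *$\psi$-complete* if for all $P_\rho$, $M_A$ and $a$ one has $p_{M_A}(a|\lambda)=\mathrm{Tr}(\rho[a]_A)$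 for $\mu_{P_\rho}$-almost every $\lambda$. On a system with Hilbert space $\mathcal H_1\otimes\mathcal H_2$ there are distinguished sets of local measurements on the first and on the second factor, represented by the operators $A\otimes 1$ and $1\otimes B$, respectively (every such operator being represented by one of them), and every local measurement $M$ on the first factor and $N$ on the second have a joint measurement with outcomes $(a,b)$ and projections $[a]_A\otimes[b]_B$. A *complete ontic model* is a collection of quantum systems, with at least one for every nonzero finite-dimensional Hilbert space, and of an ontic model for each of them, such that for any systems with Hilbert spaces $\mathcal H_1$, $\mathcal H_2$ and $\mathcal H_1\otimes\mathcal H_2$ and every preparation $P_2$ of the second one there is a Markov kernel $\gamma_{P_2}$ from $\Lambda_1$ to $\Lambda_{12}$ with the following property: for every preparation $P_1$ of the first, $\Delta\mapsto\int\gamma_{P_2}(\Delta|\lambda)\,d\mu_{P_1}(\lambda)$ is the measure of some preparation of the joint system, and this preparation is represented by $\rho_1\otimes\rho_2$ if $P_1,P_2$ are represented by $\rho_1,\rho_2$. It satisfies * *parameter independence* if for every system with Hilbert space $\mathcal H_1\otimes\mathcal H_2$, all local measurements $M$ on the first and $N$ on the second factor, with joint measurement $MN$, and all $\lambda$, $a$,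 $b$: $p_M(a|\lambda)=\sum_b p_{MN}(a,b|\lambda)$ and $p_N(b|\lambda)=\sum_a p_{MN}(a,b|\lambda)$; * *ancilla independence* if, for any systems with Hilbert spaces $\mathcal H_1$, $\mathcal H_2$, $\mathcal H_1\otimes\mathcal H_2$, for every measurement $M_A$ of the first there is a local measurement $M_{A\otimes1}$ on the joint system such that $p_{M_A}(a|\lambda)=\int p_{M_{A\otimes 1}}(a|\tilde\lambda)\,\gamma_{P_2}(d\tilde\lambda|\lambda)$ for every preparation $P_2$ of the second system, every $a$ and every $\lambda\in\Lambda_1$; * *unitary invariance* if in each of its ontic models, for all $P_\rho$, $T_U$, $M_A$ and $a$ with $\mathrm{Tr}(\rho[a]_A)=\mathrm{Tr}(U\rho U^*[a]_A)$, one has $p_{M_A}(a|\lambda)=\int p_{M_A}(a|\tilde\lambda)\,\gamma_{T_U}(d\tilde\lambda|\lambda)$ for $\mu_{P_\rho}$-almost every $\lambda$. **Theorem.** In any complete ontic model that satisfies ancilla independence, unitary invariance and parameter independence, every ontic model is $\psi$-complete. -/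

import Mathlib

open MeasureTheory ProbabilityTheory
open scoped TensorProduct

universe u v w

noncomputable section

/-- A density operator: a positive operator of trace one. -/
structure DensityOperator (H : Type) [NormedAddCommGroup H] [InnerProductSpace ℂ H] where
  op : H →ₗ[ℂ] H
  isPositive : op.IsPositive
  trace_eq_one : LinearMap.trace ℂ H op = 1

/-- A self-adjoint operator on a (finite-dimensional) Hilbert space. -/
structure Observable (H : Type) [NormedAddCommGroup H] [InnerProductSpace ℂ H] where
  op : H →ₗ[ℂ] H
  isSymmetric : op.IsSymmetric

section Born

variable {H : Type} [NormedAddCommGroup H] [InnerProductSpace ℂ H] [FiniteDimensional ℂ H]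

/-- The projection `[a]_A` onto the eigenspace of `A` for the value `a`
(the zero operator when `a` is not an eigenvalue). -/
def Observable.proj (A : Observable H) (a : ℝ) : H →ₗ[ℂ] H :=
  ((Module.End.eigenspace A.op (a : ℂ)).starProjection : H →L[ℂ] H)

theorem Observable.finite_eigenvalues (A : Observable H) :
    {a : ℝ | Module.End.HasEigenvalue A.op (a : ℂ)}.Finite :=
  (Module.End.finite_hasEigenvalue A.op).preimage Complex.ofReal_injective.injOn

/-- The possible outcomes of a measurement of `A`: the finite set of its eigenvalues. -/
def Observable.outcomes (A : Observable H) : Finset ℝ :=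
  A.finite_eigenvalues.toFinset

/-- The Born probability `Tr (ρ [a]_A)`. -/
def bornProb (ρ : H →ₗ[ℂ] H) (A : Observable H) (a : ℝ) : ℝ :=
  (LinearMap.trace ℂ H (ρ ∘ₗ A.proj a)).re

/-- The evolved state `U ρ U*`. -/
def evolve (U : H ≃ₗᵢ[ℂ] H) (ρ : H →ₗ[ℂ] H) : H →ₗ[ℂ] H :=
  (U.toLinearEquiv : H →ₗ[ℂ] H) ∘ₗ ρ ∘ₗ (U.symm.toLinearEquiv : H →ₗ[ℂ] H)

end Born

/-- A quantum system with Hilbert space `H`: sets of preparations, measurements and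
transformations, with (in general many-to-one) maps onto the density operators, the self-adjoint
operators and the unitary operators. -/
structure QuantumSystem (H : Type) [NormedAddCommGroup H] [InnerProductSpace ℂ H] where
  Prep : Type u
  Meas : Type u
  Trans : Type u
  state : Prep → DensityOperator H
  obs : Meas → Observable H
  unitary : Trans → (H ≃ₗᵢ[ℂ] H)
  state_surjective : Function.Surjective state
  obs_surjective : Function.Surjective obs
  unitary_surjective : Function.Surjective unitary

/-- An ontic model for a quantum system. -/
structure OnticModel {H : Type} [NormedAddCommGroup H] [InnerProductSpace ℂ H]
    [FiniteDimensional ℂ H] (S : QuantumSystem.{u} H) where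
  /-- the ontic states -/
  Λ : Type v
  [measurableSpace : MeasurableSpace Λ]
  /-- the distribution over ontic states of a preparation -/
  μ : S.Prep → Measure Λ
  [isProbabilityMeasure_μ : ∀ P, IsProbabilityMeasure (μ P)]
  /-- the response function of a measurement: a Markov kernel to its possible outcomes -/
  response : S.Meas → Kernel Λ ℝ
  [isMarkovKernel_response : ∀ M, IsMarkovKernel (response M)]
  response_outcomes : ∀ (M : S.Meas) (l : Λ), response M l (↑(S.obs M).outcomes)ᶜ = 0
  /-- the Markov kernel of a transformation -/
  γ : S.Trans → Kernel Λ Λ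
  [isMarkovKernel_γ : ∀ T, IsMarkovKernel (γ T)]
  born : ∀ (P : S.Prep) (M : S.Meas) (a : ℝ),
    ∫ l, (response M l).real {a} ∂(μ P) = bornProb (S.state P).op (S.obs M) a
  born_trans : ∀ (P : S.Prep) (T : S.Trans) (M : S.Meas) (a : ℝ),
    ∫ l', (∫ l, (response M l).real {a} ∂(γ T l')) ∂(μ P) =
      bornProb (evolve (S.unitary T) (S.state P).op) (S.obs M) a

namespace OnticModel

attribute [instance] OnticModel.measurableSpace OnticModel.isProbabilityMeasure_μ
  OnticModel.isMarkovKernel_response OnticModel.isMarkovKernel_γ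

variable {H : Type} [NormedAddCommGroup H] [InnerProductSpace ℂ H] [FiniteDimensional ℂ H]
  {S : QuantumSystem.{u} H}

/-- The `λ`-probability of the outcome `a` of the measurement `M` in the ontic state `l`. -/
def prob (m : OnticModel.{u, v} S) (M : S.Meas) (a : ℝ) (l : m.Λ) : ℝ :=
  (m.response M l).real {a}

/-- Triviality with respect to a set of measurements and a set of preparations. -/
def IsTrivialFor (m : OnticModel.{u, v} S) (Ms : Set S.Meas) (Ps : Set S.Prep) : Prop :=
  ∀ P ∈ Ps, ∀ M ∈ Ms, ∀ a : ℝ,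
    ∀ᵐ l ∂(m.μ P), m.prob M a l = bornProb (S.state P).op (S.obs M) a

/-- `ψ`-completeness: triviality with respect to all measurements and preparations. -/
def IsPsiComplete (m : OnticModel.{u, v} S) : Prop :=
  m.IsTrivialFor Set.univ Set.univ

/-- Unitary invariance of an ontic model. -/
def UnitaryInvariance (m : OnticModel.{u, v} S) : Prop :=
  ∀ (P : S.Prep) (T : S.Trans) (M : S.Meas) (a : ℝ),
    bornProb (S.state P).op (S.obs M) a =
        bornProb (evolve (S.unitary T) (S.state P).op) (S.obs M) a →
      ∀ᵐ l ∂(m.μ P), m.prob M a l = ∫ l', m.prob M a l' ∂(m.γ T l)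

end OnticModel

/-- The local measurements on a pair of systems with joint Hilbert space `H₁ ⊗ H₂`. Any local
measurement `M` on the first member may be carried out together with any local measurement `N` on
the second one; `joint M N` is the measurement of both, and its outcome `label M N (a, b)` stands
for the pair `(a, b)` of an outcome of `M` and an outcome of `N`. -/
structure LocalMeasurements {H₁ H₂ : Type} [NormedAddCommGroup H₁] [InnerProductSpace ℂ H₁]
    [FiniteDimensional ℂ H₁] [NormedAddCommGroup H₂] [InnerProductSpace ℂ H₂]
    [FiniteDimensional ℂ H₂] (S : QuantumSystem.{u} (H₁ ⊗[ℂ] H₂)) where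
  /-- the measurements that only involve the first system -/
  first : Set S.Meas
  /-- the measurements that only involve the second system -/
  second : Set S.Meas
  first_local : ∀ M ∈ first, ∃ A : Observable H₁,
    (S.obs M).op = TensorProduct.map A.op LinearMap.id
  second_local : ∀ N ∈ second, ∃ B : Observable H₂,
    (S.obs N).op = TensorProduct.map LinearMap.id B.op
  first_onto : ∀ A : Observable H₁, ∃ M ∈ first,
    (S.obs M).op = TensorProduct.map A.op LinearMap.id
  second_onto : ∀ B : Observable H₂, ∃ N ∈ second,
    (S.obs N).op = TensorProduct.map LinearMap.id B.op
  joint : first → second → S.Meas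
  label : first → second → ℝ × ℝ → ℝ
  label_injOn : ∀ (M : first) (N : second), Set.InjOn (label M N)
    ((↑(S.obs M).outcomes : Set ℝ) ×ˢ (↑(S.obs N).outcomes : Set ℝ))
  joint_proj : ∀ (M : first) (N : second),
    ∀ a ∈ (S.obs M).outcomes, ∀ b ∈ (S.obs N).outcomes,
      (S.obs (joint M N)).proj (label M N (a, b)) = (S.obs M).proj a ∘ₗ (S.obs N).proj b

/-- Parameter independence of an ontic model for a pair of systems: the probabilities of a local
measurement are the marginals of those of its joint measurement with any other local measurement
on the other side. -/
def OnticModel.ParameterIndependence {H₁ H₂ : Type} [NormedAddCommGroup H₁]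
    [InnerProductSpace ℂ H₁] [FiniteDimensional ℂ H₁] [NormedAddCommGroup H₂]
    [InnerProductSpace ℂ H₂] [FiniteDimensional ℂ H₂] {S : QuantumSystem.{u} (H₁ ⊗[ℂ] H₂)}
    (m : OnticModel.{u, v} S) (L : LocalMeasurements S) : Prop :=
  ∀ (M : L.first) (N : L.second) (l : m.Λ),
    (∀ a ∈ (S.obs M).outcomes, m.prob M a l =
      ∑ b ∈ (S.obs N).outcomes, m.prob (L.joint M N) (L.label M N (a, b)) l) ∧
    (∀ b ∈ (S.obs N).outcomes, m.prob N b l =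
      ∑ a ∈ (S.obs M).outcomes, m.prob (L.joint M N) (L.label M N (a, b)) l)

/-- A complete ontic model: a collection of quantum systems that comprises at least one system
for every (nonzero) finite-dimensional Hilbert space, with an ontic model for each of them, and
with Markov kernels that model the appending of an ancilla. -/
structure CompleteOnticModel where
  /-- the systems with Hilbert space `H` -/
  Sys : ∀ (H : Type) [NormedAddCommGroup H] [InnerProductSpace ℂ H] [FiniteDimensional ℂ H],
    Type w
  nonempty_sys : ∀ (H : Type) [NormedAddCommGroup H] [InnerProductSpace ℂ H]
    [FiniteDimensional ℂ H] [Nontrivial H], Nonempty (Sys H)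
  system : ∀ {H : Type} [NormedAddCommGroup H] [InnerProductSpace ℂ H] [FiniteDimensional ℂ H],
    Sys H → QuantumSystem.{u} H
  model : ∀ {H : Type} [NormedAddCommGroup H] [InnerProductSpace ℂ H] [FiniteDimensional ℂ H]
    (s : Sys H), OnticModel.{u, v} (system s)
  /-- the local measurements on a system whose Hilbert space is a tensor product -/
  localMeas : ∀ {H₁ H₂ : Type} [NormedAddCommGroup H₁] [InnerProductSpace ℂ H₁]
    [FiniteDimensional ℂ H₁] [NormedAddCommGroup H₂] [InnerProductSpace ℂ H₂]
    [FiniteDimensional ℂ H₂] (s₁₂ : Sys (H₁ ⊗[ℂ] H₂)), LocalMeasurements (system s₁₂)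
  /-- the kernel `γ_{P₂}` that appends an ancilla prepared according to `P₂` -/
  append : ∀ {H₁ H₂ : Type} [NormedAddCommGroup H₁] [InnerProductSpace ℂ H₁]
    [FiniteDimensional ℂ H₁] [NormedAddCommGroup H₂] [InnerProductSpace ℂ H₂]
    [FiniteDimensional ℂ H₂] (s₁ : Sys H₁) (s₂ : Sys H₂) (s₁₂ : Sys (H₁ ⊗[ℂ] H₂)),
    (system s₂).Prep → Kernel (model s₁).Λ (model s₁₂).Λ
  isMarkovKernel_append : ∀ {H₁ H₂ : Type} [NormedAddCommGroup H₁] [InnerProductSpace ℂ H₁]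
    [FiniteDimensional ℂ H₁] [NormedAddCommGroup H₂] [InnerProductSpace ℂ H₂]
    [FiniteDimensional ℂ H₂] (s₁ : Sys H₁) (s₂ : Sys H₂) (s₁₂ : Sys (H₁ ⊗[ℂ] H₂))
    (P₂ : (system s₂).Prep), IsMarkovKernel (append s₁ s₂ s₁₂ P₂)
  /-- `μ_{P₁P₂}` is the distribution of some preparation of the state `ρ₁ ⊗ ρ₂` -/
  exists_prep_append : ∀ {H₁ H₂ : Type} [NormedAddCommGroup H₁] [InnerProductSpace ℂ H₁]
    [FiniteDimensional ℂ H₁] [NormedAddCommGroup H₂] [InnerProductSpace ℂ H₂]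
    [FiniteDimensional ℂ H₂] (s₁ : Sys H₁) (s₂ : Sys H₂) (s₁₂ : Sys (H₁ ⊗[ℂ] H₂))
    (P₁ : (system s₁).Prep) (P₂ : (system s₂).Prep), ∃ P₁₂ : (system s₁₂).Prep,
      (model s₁₂).μ P₁₂ = ((model s₁).μ P₁).bind (append s₁ s₂ s₁₂ P₂) ∧
      ((system s₁₂).state P₁₂).op =
        TensorProduct.map ((system s₁).state P₁).op ((system s₂).state P₂).op

namespace CompleteOnticModel

/-- Every ontic model for a pair of systems satisfies parameter independence. -/
def ParameterIndependence (C : CompleteOnticModel.{u, v, w}) : Prop :=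
  ∀ (H₁ H₂ : Type) [NormedAddCommGroup H₁] [InnerProductSpace ℂ H₁]
    [FiniteDimensional ℂ H₁] [NormedAddCommGroup H₂] [InnerProductSpace ℂ H₂]
    [FiniteDimensional ℂ H₂] (s₁₂ : C.Sys (H₁ ⊗[ℂ] H₂)),
    (C.model s₁₂).ParameterIndependence (C.localMeas s₁₂)

/-- Every ontic model satisfies unitary invariance. -/
def UnitaryInvariance (C : CompleteOnticModel.{u, v, w}) : Prop :=
  ∀ (H : Type) [NormedAddCommGroup H] [InnerProductSpace ℂ H] [FiniteDimensional ℂ H]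
    (s : C.Sys H), (C.model s).UnitaryInvariance

/-- Ancilla independence: the probabilities for an individual system are averages of those of a
local measurement on the joint system, whatever the preparation of the ancilla. -/
def AncillaIndependence (C : CompleteOnticModel.{u, v, w}) : Prop :=
  ∀ (H₁ H₂ : Type) [NormedAddCommGroup H₁] [InnerProductSpace ℂ H₁]
    [FiniteDimensional ℂ H₁] [NormedAddCommGroup H₂] [InnerProductSpace ℂ H₂]
    [FiniteDimensional ℂ H₂] (s₁ : C.Sys H₁) (s₂ : C.Sys H₂) (s₁₂ : C.Sys (H₁ ⊗[ℂ] H₂))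
    (M : (C.system s₁).Meas), ∃ M' ∈ (C.localMeas s₁₂).first,
      ((C.system s₁₂).obs M').op = TensorProduct.map ((C.system s₁).obs M).op LinearMap.id ∧
      ∀ (P₂ : (C.system s₂).Prep) (a : ℝ) (l : (C.model s₁).Λ),
        (C.model s₁).prob M a l =
          ∫ l', (C.model s₁₂).prob M' a l' ∂(C.append s₁ s₂ s₁₂ P₂ l)

end CompleteOnticModel

end

noncomputable section

/-! ### Spectral projections of observables, also on tensor products. -/

section Spectral

variable {X Y : Type} [NormedAddCommGroup X] [InnerProductSpace ℂ X]
  [NormedAddCommGroup Y] [InnerProductSpace ℂ Y]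

/-! Fix a preparation with state `ρ`, a measurement of `A` and an outcome `a` of Born probability
`w`. The claim is that the mean deviation `∫ |p(a|λ) - w| dμ` vanishes. By Jensen's inequality this
deviation can only grow when `p(a|·)` is replaced by a function of which it is a kernel average.
Ancilla independence and unitary invariance provide such averages, so it suffices to bound the
deviation in a conveniently enlarged and evolved system.

The enlarged space is `G ⊗ (D ⊗ H)` with `G = H ⊗ D`. After two ancillas have been appended, a
unitary moves `ρ` into the last factor and puts `G ⊗ D` into a pure state `Ψ = ∑ αᵢ gᵢ ⊗ dᵢ`. The
`gᵢ` lie in the `a`-eigenspace of `A ⊗ 1` or in its complement, and the weights `αᵢ²` inside the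
eigenspace sum to `w`. Hence the Born probability of `a` is unchanged, and unitary invariance
applies (`CompleteOnticModel.card_mul_integral_abs_sub_le`).

In the state `Ψ`, parameter independence bounds the mean difference of the probabilities of two
local outcomes by `‖XΨ - YΨ‖²`, where `X`, `Y` are their projections. Perfectly correlated outcomes
thus have almost surely equal probabilities. If `αᵢ = αⱼ`, then `Ψ` looks the same along every
simultaneous rotation of the planes of `gᵢ, gⱼ` and `dᵢ, dⱼ`. Rotating from `dᵢ` to `dⱼ` in `n`
steps costs `O(1/n²)` per step, so the outcomes `dᵢ` and `dⱼ` are almost surely equiprobable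
(`OnticModel.ParameterIndependence.ae_prob_eq`).

Finally the eigenspace receives about `nw` cells of weight `1/n` and its complement about `n(1-w)`,
with one remainder on each side. Equiprobability of the cells forces `p(a|λ)` to be close to `w` on
average, with an error of at most `2/(n-2)`. -/

theorem isSymmetric_map {S : X →ₗ[ℂ] X} {T : Y →ₗ[ℂ] Y} (hS : S.IsSymmetric)
    (hT : T.IsSymmetric) : (TensorProduct.map S T).IsSymmetric := by
  intro z z'
  induction z with
  | zero => simp
  | add a b ha hb => simp only [map_add, inner_add_left, ha, hb]
  | tmul x y =>
    induction z' with
    | zero => simp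
    | add a b ha hb => simp only [map_add, inner_add_right, ha, hb]
    | tmul x' y' => simp [hS x x', hT y y']

/-- The observable `A ⊗ 1`. -/
def Observable.tmulOne (A : Observable X) (Y : Type) [NormedAddCommGroup Y]
    [InnerProductSpace ℂ Y] : Observable (X ⊗[ℂ] Y) where
  op := TensorProduct.map A.op LinearMap.id
  isSymmetric := isSymmetric_map A.isSymmetric LinearMap.IsSymmetric.id

variable [FiniteDimensional ℂ X] [FiniteDimensional ℂ Y]

theorem Observable.op_proj_apply (A : Observable X) (a : ℝ) (x : X) :
    A.op (A.proj a x) = (a : ℂ) • A.proj a x :=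
  Module.End.mem_eigenspace_iff.1 (Submodule.starProjection_apply_mem _ x)

theorem Observable.proj_apply_eq_self (A : Observable X) {a : ℝ} {x : X}
    (h : A.op x = (a : ℂ) • x) : A.proj a x = x :=
  Submodule.starProjection_eq_self_iff.2 (Module.End.mem_eigenspace_iff.2 h)

theorem Observable.proj_proj_apply (A : Observable X) (a : ℝ) (x : X) :
    A.proj a (A.proj a x) = A.proj a x :=
  A.proj_apply_eq_self (A.op_proj_apply a x)

theorem Observable.inner_proj_left (A : Observable X) (a : ℝ) (x y : X) :
    inner ℂ (A.proj a x) y = inner ℂ x (A.proj a y) :=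
  Submodule.inner_starProjection_left_eq_right _ x y

theorem Observable.proj_isSymmetric (A : Observable X) (a : ℝ) : (A.proj a).IsSymmetric :=
  A.inner_proj_left a

theorem Observable.mem_outcomes (A : Observable X) (a : ℝ) :
    a ∈ A.outcomes ↔ Module.End.HasEigenvalue A.op (a : ℂ) := by
  simp [Observable.outcomes]

theorem Observable.mem_outcomes_iff (A : Observable X) (a : ℝ) :
    a ∈ A.outcomes ↔ A.proj a ≠ 0 := by
  rw [A.mem_outcomes]
  constructor
  · intro h h0
    obtain ⟨x, hx⟩ := h.exists_hasEigenvector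
    have := A.proj_apply_eq_self hx.apply_eq_smul
    rw [h0] at this
    exact hx.2 this.symm
  · intro h
    obtain ⟨x, hx⟩ : ∃ x, A.proj a x ≠ 0 := by
      by_contra! hh
      exact h (LinearMap.ext hh)
    exact Module.End.hasEigenvalue_of_hasEigenvector
      ⟨Module.End.mem_eigenspace_iff.2 (A.op_proj_apply a x), hx⟩

theorem Observable.proj_eq_zero (A : Observable X) {a : ℝ} (h : a ∉ A.outcomes) :
    A.proj a = 0 := by
  by_contra h'
  exact h ((A.mem_outcomes_iff a).2 h')

theorem Observable.proj_apply_of_ne (A : Observable X) {a b : ℝ} (hab : a ≠ b) {x : X}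
    (h : A.op x = (b : ℂ) • x) : A.proj a x = 0 := by
  have h1 : ∀ y, inner ℂ (A.proj a x) y = 0 := by
    intro y
    have h2 := A.isSymmetric (A.proj a y) x
    rw [A.op_proj_apply, h, inner_smul_left, inner_smul_right, Complex.conj_ofReal] at h2
    have h3 : ((a : ℂ) - b) * inner ℂ (A.proj a y) x = 0 := by rw [sub_mul, h2, sub_self]
    rcases mul_eq_zero.1 h3 with h4 | h4
    · exact absurd (Complex.ofReal_injective (sub_eq_zero.1 h4)) hab
    · rw [A.inner_proj_left] at h4
      rw [← inner_conj_symm, h4, map_zero]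
  exact inner_self_eq_zero.1 (h1 _)

theorem Observable.proj_proj_of_ne (A : Observable X) {a b : ℝ} (hab : a ≠ b) (x : X) :
    A.proj a (A.proj b x) = 0 :=
  A.proj_apply_of_ne hab (A.op_proj_apply b x)

theorem Observable.sum_proj (A : Observable X) : ∑ a ∈ A.outcomes, A.proj a = LinearMap.id := by
  have htop : (⨆ μ : ℂ, Module.End.eigenspace A.op μ) = ⊤ :=
    Submodule.orthogonal_eq_bot_iff.1 A.isSymmetric.orthogonalComplement_iSup_eigenspaces_eq_bot
  ext x
  have hx : x ∈ ⨆ μ : ℂ, Module.End.eigenspace A.op μ := htop ▸ Submodule.mem_top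
  induction hx using Submodule.iSup_induction' with
  | zero => simp
  | add x y _ _ hx hy => simp only [map_add, hx, hy]
  | mem μ x hx =>
    by_cases h0 : x = 0
    · simp [h0]
    have hev : Module.End.HasEigenvalue A.op μ :=
      Module.End.hasEigenvalue_of_hasEigenvector ⟨hx, h0⟩
    have hreal : ((μ.re : ℝ) : ℂ) = μ := by
      have := A.isSymmetric.conj_eigenvalue_eq_self hev
      exact Complex.conj_eq_iff_re.1 this
    have hx' : A.op x = ((μ.re : ℝ) : ℂ) • x := by
      rw [hreal]; exact Module.End.mem_eigenspace_iff.1 hx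
    rw [LinearMap.sum_apply, Finset.sum_eq_single μ.re]
    · simpa using A.proj_apply_eq_self hx'
    · intro b _ hb
      exact A.proj_apply_of_ne hb hx'
    · intro h
      rw [A.proj_eq_zero h]
      exact absurd ((A.mem_outcomes _).2 (hreal.symm ▸ hev)) h

/-- The spectral projections of an operator are read off from a resolution of the identity by
operators that map into its eigenspaces. -/
theorem Observable.proj_eq_sum {ι : Type*} (A : Observable X) (s : Finset ι) (β : ι → ℝ)
    (R : ι → X →ₗ[ℂ] X) (hR : ∀ i ∈ s, ∀ x, A.op (R i x) = (β i : ℂ) • R i x)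
    (hsum : ∑ i ∈ s, R i = LinearMap.id) (a : ℝ) [DecidablePred fun i => β i = a] :
    A.proj a = ∑ i ∈ s with β i = a, R i := by
  ext x
  have hx : x = ∑ i ∈ s, R i x := by rw [← LinearMap.sum_apply, hsum, LinearMap.id_apply]
  conv_lhs => rw [hx]
  rw [map_sum, LinearMap.sum_apply, Finset.sum_filter]
  refine Finset.sum_congr rfl fun i hi => ?_
  split_ifs with h
  · exact A.proj_apply_eq_self (h ▸ hR i hi x)
  · exact A.proj_apply_of_ne (Ne.symm h) (hR i hi x)

/-- The operators `[b]_A ⊗ 1` resolve the identity and map into eigenspaces of `A ⊗ 1`, so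
`Observable.proj_eq_sum` identifies them. Values outside the spectrum are covered, both sides being
zero. -/
theorem Observable.proj_of_op_eq_map_id {B : Observable (X ⊗[ℂ] Y)} {A : Observable X}
    (h : B.op = TensorProduct.map A.op LinearMap.id) (a : ℝ) :
    B.proj a = TensorProduct.map (A.proj a) LinearMap.id := by
  classical
  rw [B.proj_eq_sum A.outcomes id (fun b => TensorProduct.map (A.proj b) LinearMap.id)]
  · by_cases ha : a ∈ A.outcomes
    · simp [Finset.filter_eq', ha]
    · simp [Finset.filter_eq', ha, A.proj_eq_zero ha]
  · intro b _ z
    induction z with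
    | zero => simp
    | add z z' hz hz' => simp only [map_add, smul_add, hz, hz']
    | tmul x y => simp [h, A.op_proj_apply, TensorProduct.smul_tmul']
  · have := congrArg (fun f => TensorProduct.map f (LinearMap.id : Y →ₗ[ℂ] Y)) A.sum_proj
    simp only [TensorProduct.map_id] at this
    rw [← this]
    simp only [← TensorProduct.mapBilinear_apply (R := ℂ), map_sum, LinearMap.sum_apply]

theorem Observable.proj_of_op_eq_id_map {B : Observable (Y ⊗[ℂ] X)} {A : Observable X}
    (h : B.op = TensorProduct.map LinearMap.id A.op) (a : ℝ) :
    B.proj a = TensorProduct.map LinearMap.id (A.proj a) := by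
  classical
  rw [B.proj_eq_sum A.outcomes id (fun b => TensorProduct.map LinearMap.id (A.proj b))]
  · by_cases ha : a ∈ A.outcomes
    · simp [Finset.filter_eq', ha]
    · simp [Finset.filter_eq', ha, A.proj_eq_zero ha]
  · intro b _ z
    induction z with
    | zero => simp
    | add z z' hz hz' => simp only [map_add, smul_add, hz, hz']
    | tmul x y => simp [h, A.op_proj_apply, -Complex.coe_smul]
  · have := congrArg (fun f => TensorProduct.map (LinearMap.id : Y →ₗ[ℂ] Y) f) A.sum_proj
    simp only [TensorProduct.map_id] at this
    rw [← this]
    simp only [← TensorProduct.mapBilinear_apply (R := ℂ), map_sum]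

/-- The one-dimensional projection onto the line spanned by a unit vector. -/
def Observable.ofUnit (v : X) : Observable X where
  op := (InnerProductSpace.rankOne ℂ v v : X →L[ℂ] X)
  isSymmetric := InnerProductSpace.isSymmetric_rankOne_self v

theorem Observable.ofUnit_proj_apply {v : X} (hv : ‖v‖ = 1) (x : X) :
    (Observable.ofUnit v).proj 1 x = inner ℂ v x • v := by
  classical
  -- The resolution consists of the line of `v`, with eigenvalue 1, and its complement, with
  -- eigenvalue 0.
  rw [(Observable.ofUnit v).proj_eq_sum Finset.univ (fun i : Bool => if i then (1 : ℝ) else 0)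
    (fun i => if i then ((InnerProductSpace.rankOne ℂ v v : X →L[ℂ] X) : X →ₗ[ℂ] X)
      else LinearMap.id - ((InnerProductSpace.rankOne ℂ v v : X →L[ℂ] X) : X →ₗ[ℂ] X))]
  · simp [Finset.sum_filter]
  · intro i _ x
    cases i <;> simp [Observable.ofUnit, inner_sub_right, inner_smul_right, hv]
  · simp

variable {ι : Type} [Fintype ι]

/-- The observable with the vectors of an orthonormal basis as eigenvectors and with the given
eigenvalues. -/
def Observable.diagonal (b : OrthonormalBasis ι ℂ X) (β : ι → ℝ) : Observable X where
  op := ∑ i, (β i : ℂ) • ((InnerProductSpace.rankOne ℂ (b i) (b i) : X →L[ℂ] X) : X →ₗ[ℂ] X)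
  isSymmetric := by
    intro x y
    simp only [LinearMap.sum_apply, LinearMap.smul_apply, sum_inner, inner_sum, inner_smul_left,
      inner_smul_right, Complex.conj_ofReal]
    refine Finset.sum_congr rfl fun i _ => ?_
    congr 1
    exact InnerProductSpace.isSymmetric_rankOne_self (b i) x y

theorem Observable.diagonal_proj_apply (b : OrthonormalBasis ι ℂ X) {β : ι → ℝ}
    (hβ : Function.Injective β) (i : ι) (x : X) :
    (Observable.diagonal b β).proj (β i) x = inner ℂ (b i) x • b i := by
  classical
  rw [(Observable.diagonal b β).proj_eq_sum Finset.univ β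
    (fun i => (InnerProductSpace.rankOne ℂ (b i) (b i) : X →L[ℂ] X))]
  · simp [hβ.eq_iff, Finset.sum_filter]
  · intro i _ x
    simp [Observable.diagonal, b.inner_eq_ite, smul_smul, mul_comm,
      -Complex.coe_smul]
  · ext x
    simpa using b.sum_repr' x

end Spectral

/-! ### Averages with respect to Markov kernels. -/

section Measure

theorem integral_bind_of_bounded {α β : Type*} [MeasurableSpace α] [MeasurableSpace β]
    (μ : Measure α) [IsProbabilityMeasure μ] (κ : Kernel α β) [IsMarkovKernel κ] {f : β → ℝ}
    (hf : Measurable f) {c : ℝ} (hc : ∀ x, |f x| ≤ c) :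
    ∫ y, f y ∂(μ.bind κ) = ∫ x, ∫ y, f y ∂(κ x) ∂μ := by
  have h : μ.bind κ = (κ ∘ₖ Kernel.const Unit μ) () := by rw [Kernel.comp_apply, Kernel.const_apply]
  rw [h, Kernel.integral_comp, Kernel.const_apply]
  exact Integrable.of_bound hf.aestronglyMeasurable c (.of_forall hc)

/-- Jensen's inequality for averages with respect to a kernel. -/
theorem integral_abs_sub_le_of_average {α β : Type*} [MeasurableSpace α] [MeasurableSpace β]
    (μ : Measure α) [IsProbabilityMeasure μ] (κ : Kernel α β) [IsMarkovKernel κ]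
    {f : α → ℝ} {g : β → ℝ} (hf : Measurable f) (hg : Measurable g)
    (hf0 : ∀ x, 0 ≤ f x) (hf1 : ∀ x, f x ≤ 1) (hg0 : ∀ x, 0 ≤ g x) (hg1 : ∀ x, g x ≤ 1)
    (h : ∀ᵐ x ∂μ, f x = ∫ y, g y ∂(κ x)) (w : ℝ) :
    ∫ x, |f x - w| ∂μ ≤ ∫ y, |g y - w| ∂(μ.bind κ) := by
  have hbg : ∀ y, |(|g y - w|)| ≤ 1 + |w| := fun y => by
    rw [abs_abs]
    refine (abs_sub _ _).trans ?_
    rw [abs_of_nonneg (hg0 y)]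
    linarith [hg1 y]
  have hbf : ∀ y, |(|f y - w|)| ≤ 1 + |w| := fun y => by
    rw [abs_abs]
    refine (abs_sub _ _).trans ?_
    rw [abs_of_nonneg (hf0 y)]
    linarith [hf1 y]
  have hgm : Measurable fun y => |g y - w| := (hg.sub_const w).abs
  have hgi : Integrable (fun x => ∫ y, |g y - w| ∂(κ x)) μ :=
    Integrable.of_bound hgm.stronglyMeasurable.integral_kernel.aestronglyMeasurable (1 + |w|)
      (.of_forall fun x => by
        simpa using norm_integral_le_of_norm_le_const (μ := κ x) (f := fun y => |g y - w|)
          (C := 1 + |w|) (.of_forall hbg))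
  rw [integral_bind_of_bounded μ κ hgm hbg]
  refine integral_mono_ae
    (Integrable.of_bound (hf.sub_const w).abs.aestronglyMeasurable (1 + |w|) (.of_forall hbf))
    hgi ?_
  filter_upwards [h] with x hx
  have hgx : Integrable g (κ x) :=
    Integrable.of_bound hg.aestronglyMeasurable 1 (.of_forall fun y => by
      rw [Real.norm_of_nonneg (hg0 y)]; exact hg1 y)
  calc |f x - w| = |∫ y, (g y - w) ∂(κ x)| := by
        rw [integral_sub hgx (integrable_const w), hx]; simp
    _ ≤ ∫ y, |g y - w| ∂(κ x) := abs_integral_le_integral_abs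

end Measure

/-! ### Elementary bounds on response probabilities, and distributions with Born statistics. -/

namespace OnticModel

variable {H : Type} [NormedAddCommGroup H] [InnerProductSpace ℂ H] [FiniteDimensional ℂ H]
  {S : QuantumSystem.{u} H} (m : OnticModel.{u, v} S)

theorem prob_nonneg (M : S.Meas) (a : ℝ) (l : m.Λ) : 0 ≤ m.prob M a l := measureReal_nonneg

theorem prob_le_one (M : S.Meas) (a : ℝ) (l : m.Λ) : m.prob M a l ≤ 1 := measureReal_le_one

theorem measurable_prob (M : S.Meas) (a : ℝ) : Measurable (m.prob M a) :=
  ((m.response M).measurable_coe (measurableSet_singleton a)).ennreal_toReal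

theorem sum_prob_le_one (M : S.Meas) (s : Finset ℝ) (l : m.Λ) :
    ∑ a ∈ s, m.prob M a l ≤ 1 := by
  have := sum_measureReal_singleton (μ := m.response M l) s
  simp only [prob]
  rw [this]
  exact measureReal_le_one

theorem integrable_prob (ν : Measure m.Λ) [IsProbabilityMeasure ν] (M : S.Meas) (a : ℝ) :
    Integrable (m.prob M a) ν :=
  Integrable.of_bound (m.measurable_prob M a).aestronglyMeasurable 1 (.of_forall fun l => by
    rw [Real.norm_of_nonneg (m.prob_nonneg M a l)]; exact m.prob_le_one M a l)

/-- The distribution `ν` over ontic states reproduces the Born statistics of the operator `σ`. -/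
def ReproducesBorn (ν : Measure m.Λ) (σ : H →ₗ[ℂ] H) : Prop :=
  ∀ (M : S.Meas) (a : ℝ), ∫ l, m.prob M a l ∂ν = bornProb σ (S.obs M) a

theorem reproducesBorn_μ (P : S.Prep) : m.ReproducesBorn (m.μ P) (S.state P).op :=
  fun M a => m.born P M a

/-- The evolved distribution is not assumed to belong to any preparation; this is why
`ReproducesBorn` is stated for arbitrary measures. -/
theorem reproducesBorn_bind (P : S.Prep) (T : S.Trans) :
    m.ReproducesBorn ((m.μ P).bind (m.γ T)) (evolve (S.unitary T) (S.state P).op) := by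
  intro M a
  rw [integral_bind_of_bounded _ _ (m.measurable_prob M a) (c := 1), ← m.born_trans]
  · rfl
  · intro l
    rw [abs_of_nonneg (m.prob_nonneg M a l)]
    exact m.prob_le_one M a l

end OnticModel

/-! ### Parameter independence and the disagreement of two local outcomes. -/

section Bipartite

variable {H₁ H₂ : Type} [NormedAddCommGroup H₁]
    [InnerProductSpace ℂ H₁] [FiniteDimensional ℂ H₁] [NormedAddCommGroup H₂]
    [InnerProductSpace ℂ H₂] [FiniteDimensional ℂ H₂] {S : QuantumSystem.{u} (H₁ ⊗[ℂ] H₂)}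
    (m : OnticModel.{u, v} S) (L : LocalMeasurements S)

/-- Parameter independence bounds the mean difference of the probabilities for the two sides by
the probability that the outcomes of the joint measurement disagree. -/
theorem OnticModel.ParameterIndependence.integral_abs_sub_le (hPI : m.ParameterIndependence L)
    {ν : Measure m.Λ} [IsProbabilityMeasure ν] {σ : H₁ ⊗[ℂ] H₂ →ₗ[ℂ] H₁ ⊗[ℂ] H₂}
    (hν : m.ReproducesBorn ν σ) (M : L.first) (N : L.second) {a : ℝ}
    (ha : a ∈ (S.obs M).outcomes) {B : Finset ℝ} (hB : B ⊆ (S.obs N).outcomes) :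
    ∫ l, |m.prob M a l - ∑ b ∈ B, m.prob N b l| ∂ν ≤
      (LinearMap.trace ℂ _ (σ ∘ₗ
        ((S.obs M).proj a ∘ₗ (LinearMap.id - ∑ b ∈ B, (S.obs N).proj b) +
          (LinearMap.id - (S.obs M).proj a) ∘ₗ ∑ b ∈ B, (S.obs N).proj b))).re := by
  classical
  set J : ℝ → ℝ → m.Λ → ℝ := fun a b l => m.prob (L.joint M N) (L.label M N (a, b)) l with hJ
  have hJi : ∀ a b, Integrable (J a b) ν := fun a b => m.integrable_prob ν _ _
  have hJ0 : ∀ a b l, 0 ≤ J a b l := fun a b l => m.prob_nonneg _ _ _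
  have hJint : ∀ a' ∈ (S.obs M).outcomes, ∀ b ∈ (S.obs N).outcomes, ∫ l, J a' b l ∂ν =
      (LinearMap.trace ℂ _ (σ ∘ₗ ((S.obs M).proj a' ∘ₗ (S.obs N).proj b))).re := by
    intro a' ha' b hb
    rw [hν (L.joint M N), bornProb, L.joint_proj M N a' ha' b hb]
  -- Writing both marginals through the same joint measurement, the event that both outcomes occur
  -- cancels. What remains is the difference of the two disagreement probabilities, "`a` but not
  -- `B`" and "`B` but not `a`".
  have hpt : ∀ l, |m.prob M a l - ∑ b ∈ B, m.prob N b l| ≤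
      ∑ b ∈ (S.obs N).outcomes \ B, J a b l +
        ∑ a' ∈ (S.obs M).outcomes.erase a, ∑ b ∈ B, J a' b l := by
    intro l
    have h1 : m.prob M a l = ∑ b ∈ (S.obs N).outcomes \ B, J a b l + ∑ b ∈ B, J a b l := by
      rw [Finset.sum_sdiff hB, (hPI M N l).1 a ha]
    have h2 : ∑ b ∈ B, m.prob N b l =
        ∑ b ∈ B, J a b l + ∑ a' ∈ (S.obs M).outcomes.erase a, ∑ b ∈ B, J a' b l := by
      rw [Finset.add_sum_erase _ (fun a' => ∑ b ∈ B, J a' b l) ha, Finset.sum_comm]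
      exact Finset.sum_congr rfl fun b hb => (hPI M N l).2 b (hB hb)
    rw [h1, h2, abs_le]
    have h3 : 0 ≤ ∑ b ∈ (S.obs N).outcomes \ B, J a b l :=
      Finset.sum_nonneg fun b _ => hJ0 _ _ _
    have h4 : 0 ≤ ∑ a' ∈ (S.obs M).outcomes.erase a, ∑ b ∈ B, J a' b l :=
      Finset.sum_nonneg fun a' _ => Finset.sum_nonneg fun b _ => hJ0 _ _ _
    constructor <;> linarith
  have hNsum : LinearMap.id - ∑ b ∈ B, (S.obs N).proj b =
      ∑ b ∈ (S.obs N).outcomes \ B, (S.obs N).proj b := by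
    rw [← (S.obs N).sum_proj, ← Finset.sum_sdiff hB, add_sub_cancel_right]
  have hMsum : LinearMap.id - (S.obs M).proj a =
      ∑ a' ∈ (S.obs M).outcomes.erase a, (S.obs M).proj a' := by
    rw [← (S.obs M).sum_proj, ← Finset.add_sum_erase _ _ ha, add_sub_cancel_left]
  have hi1 : Integrable (fun l => ∑ b ∈ (S.obs N).outcomes \ B, J a b l) ν :=
    integrable_finsetSum _ fun b _ => hJi a b
  have hi2 : Integrable (fun l => ∑ a' ∈ (S.obs M).outcomes.erase a, ∑ b ∈ B, J a' b l) ν :=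
    integrable_finsetSum _ fun a' _ => integrable_finsetSum _ fun b _ => hJi a' b
  have hi0 : Integrable (fun l => |m.prob M a l - ∑ b ∈ B, m.prob N b l|) ν :=
    ((m.integrable_prob ν M a).sub (integrable_finsetSum _ fun b _ => m.integrable_prob ν N b)).abs
  refine (integral_mono hi0 (hi1.add hi2) hpt).trans_eq ?_
  have e1 : ∫ l, (∑ b ∈ (S.obs N).outcomes \ B, J a b l) ∂ν = (LinearMap.trace ℂ _ (σ ∘ₗ
      ((S.obs M).proj a ∘ₗ ∑ b ∈ (S.obs N).outcomes \ B, (S.obs N).proj b))).re := by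
    rw [integral_finsetSum _ fun b _ => hJi a b,
      Finset.sum_congr rfl fun b hb => hJint a ha b (Finset.mem_sdiff.1 hb).1]
    simp only [← Module.End.mul_eq_comp, Finset.mul_sum, map_sum, Complex.re_sum]
  have e2 : ∫ l, (∑ a' ∈ (S.obs M).outcomes.erase a, ∑ b ∈ B, J a' b l) ∂ν =
      (LinearMap.trace ℂ _ (σ ∘ₗ ((∑ a' ∈ (S.obs M).outcomes.erase a, (S.obs M).proj a') ∘ₗ
        ∑ b ∈ B, (S.obs N).proj b))).re := by
    rw [integral_finsetSum _ fun a' _ => integrable_finsetSum _ fun b _ => hJi a' b]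
    simp only [← Module.End.mul_eq_comp, Finset.mul_sum, Finset.sum_mul, map_sum, Complex.re_sum]
    rw [Finset.sum_comm]
    refine Finset.sum_congr rfl fun a' ha' => ?_
    rw [integral_finsetSum _ fun b _ => hJi a' b]
    exact Finset.sum_congr rfl fun b hb => hJint a' (Finset.mem_of_mem_erase ha') b (hB hb)
  rw [hNsum, hMsum, LinearMap.comp_add, map_add, Complex.add_re, ← e1, ← e2]
  exact integral_add hi1 hi2

end Bipartite

/-! ### Isometric embeddings of states and the unitaries between them. -/

section Tensor

variable {G D H E V : Type} [NormedAddCommGroup G] [InnerProductSpace ℂ G]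
  [NormedAddCommGroup D] [InnerProductSpace ℂ D]
  [NormedAddCommGroup H] [InnerProductSpace ℂ H]
  [NormedAddCommGroup E] [InnerProductSpace ℂ E]
  [NormedAddCommGroup V] [InnerProductSpace ℂ V]

theorem nontrivial_tensorProduct [Nontrivial G] [Nontrivial D] : Nontrivial (G ⊗[ℂ] D) := by
  obtain ⟨g, hg⟩ := exists_ne (0 : G)
  obtain ⟨d, hd⟩ := exists_ne (0 : D)
  refine ⟨g ⊗ₜ d, 0, fun h => ?_⟩
  have := TensorProduct.norm_tmul (𝕜 := ℂ) g d
  rw [h, norm_zero] at this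
  exact (mul_ne_zero (norm_ne_zero_iff.2 hg) (norm_ne_zero_iff.2 hd)) this.symm

/-- The isometry `h ↦ Ψ ⊗ h` of a unit vector `Ψ` of `G ⊗ D`, with values in `G ⊗ (D ⊗ H)`. -/
def tensorIsometry (Ψ : G ⊗[ℂ] D) (hΨ : ‖Ψ‖ = 1) : H →ₗᵢ[ℂ] G ⊗[ℂ] (D ⊗[ℂ] H) where
  toLinearMap := (TensorProduct.assoc ℂ G D H).toLinearMap ∘ₗ TensorProduct.mk ℂ (G ⊗[ℂ] D) H Ψ
  norm_map' h := by
    change ‖TensorProduct.assocIsometry ℂ G D H (Ψ ⊗ₜ h)‖ = ‖h‖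
    rw [LinearIsometryEquiv.norm_map, TensorProduct.norm_tmul, hΨ, one_mul]

theorem tensorIsometry_apply (Ψ : G ⊗[ℂ] D) (hΨ : ‖Ψ‖ = 1) (h : H) :
    tensorIsometry Ψ hΨ h = TensorProduct.assocIsometry ℂ G D H (Ψ ⊗ₜ h) := rfl

theorem map_map_assoc (x : G →ₗ[ℂ] G) (y : D →ₗ[ℂ] D) (Ψ : G ⊗[ℂ] D) (h : H) :
    TensorProduct.map x (TensorProduct.map y LinearMap.id)
        (TensorProduct.assocIsometry ℂ G D H (Ψ ⊗ₜ h)) =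
      TensorProduct.assocIsometry ℂ G D H (TensorProduct.map x y Ψ ⊗ₜ h) := by
  induction Ψ with
  | zero => simp
  | add a b ha hb => simp only [map_add, TensorProduct.add_tmul, ha, hb]
  | tmul g d => rfl

/-- Two isometric embeddings differ by a unitary of the ambient space. -/
theorem exists_unitary_comp_eq [FiniteDimensional ℂ V] (J₀ J₁ : H →ₗᵢ[ℂ] V) :
    ∃ U : V ≃ₗᵢ[ℂ] V, ∀ h, U (J₀ h) = J₁ h := by
  let e : H ≃ₗᵢ[ℂ] LinearMap.range J₀.toLinearMap := J₀.equivRange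
  let L : LinearMap.range J₀.toLinearMap →ₗᵢ[ℂ] V := J₁.comp e.symm.toLinearIsometry
  -- The isometry between the two ranges extends to the ambient space, where finite dimension makes
  -- it onto.
  refine ⟨L.extend.toLinearIsometryEquiv rfl, fun h => ?_⟩
  have h1 := L.extend_apply (e h)
  have h2 : ((e h : LinearMap.range J₀.toLinearMap) : V) = J₀ h := rfl
  rw [h2] at h1
  simpa [L] using h1

/-- The pure state of a unit vector. -/
def DensityOperator.pure [FiniteDimensional ℂ E] (e : E) (he : ‖e‖ = 1) : DensityOperator E where
  op := (InnerProductSpace.rankOne ℂ e e : E →L[ℂ] E)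
  isPositive := (InnerProductSpace.isPositive_rankOne_self e).toLinearMap
  trace_eq_one := by
    rw [InnerProductSpace.trace_rankOne, inner_self_eq_norm_sq_to_K, he]; simp

/-- The isometry `h ↦ h ⊗ e` of a unit vector `e`. -/
def tmulIsometry (e : E) (he : ‖e‖ = 1) : H →ₗᵢ[ℂ] H ⊗[ℂ] E where
  toLinearMap := (TensorProduct.mk ℂ H E).flip e
  norm_map' h := by simp [he]

variable [FiniteDimensional ℂ H] [FiniteDimensional ℂ V]

/-- The state `J ρ J*`. -/
def embedState (J : H →ₗᵢ[ℂ] V) (ρ : H →ₗ[ℂ] H) : V →ₗ[ℂ] V :=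
  J.toLinearMap ∘ₗ ρ ∘ₗ LinearMap.adjoint J.toLinearMap

/-- The hypothesis says that `J* Z J = c`, and the trace is cyclic. -/
theorem trace_embedState_comp (J : H →ₗᵢ[ℂ] V) (ρ : H →ₗ[ℂ] H) (Z : V →ₗ[ℂ] V) (c : ℂ)
    (hZ : ∀ h h', inner ℂ (J h') (Z (J h)) = c * inner ℂ h' h) :
    LinearMap.trace ℂ V (embedState J ρ ∘ₗ Z) = c * LinearMap.trace ℂ H ρ := by
  have h1 : LinearMap.adjoint J.toLinearMap ∘ₗ Z ∘ₗ J.toLinearMap = c • LinearMap.id := by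
    ext h
    refine ext_inner_left ℂ fun h' => ?_
    rw [LinearMap.comp_apply, LinearMap.adjoint_inner_right, LinearMap.smul_apply,
      inner_smul_right]
    exact hZ h h'
  have h2 : embedState J ρ ∘ₗ Z =
      J.toLinearMap ∘ₗ (ρ ∘ₗ LinearMap.adjoint J.toLinearMap ∘ₗ Z) := rfl
  rw [h2, LinearMap.trace_comp_comm',
    show (ρ ∘ₗ LinearMap.adjoint J.toLinearMap ∘ₗ Z) ∘ₗ J.toLinearMap =
      ρ ∘ₗ (LinearMap.adjoint J.toLinearMap ∘ₗ Z ∘ₗ J.toLinearMap) from rfl, h1,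
    LinearMap.comp_smul, map_smul, LinearMap.comp_id, smul_eq_mul]

/-- An operator `x ⊗ y ⊗ 1` does not see the last factor, to which `ρ` has been moved. Its
statistics are those of the pure state `Ψ`, although `ρ` may be mixed. -/
theorem trace_embedState_tensorIsometry [FiniteDimensional ℂ G] [FiniteDimensional ℂ D]
    (Ψ : G ⊗[ℂ] D) (hΨ : ‖Ψ‖ = 1) (ρ : H →ₗ[ℂ] H) (x : G →ₗ[ℂ] G) (y : D →ₗ[ℂ] D) :
    LinearMap.trace ℂ (G ⊗[ℂ] (D ⊗[ℂ] H))
        (embedState (V := G ⊗[ℂ] (D ⊗[ℂ] H)) (tensorIsometry Ψ hΨ) ρ ∘ₗ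
          TensorProduct.map x (TensorProduct.map y LinearMap.id)) =
      inner ℂ Ψ (TensorProduct.map x y Ψ) * LinearMap.trace ℂ H ρ := by
  refine trace_embedState_comp (V := G ⊗[ℂ] (D ⊗[ℂ] H)) (tensorIsometry Ψ hΨ) ρ _ _ fun h h' => ?_
  rw [tensorIsometry_apply, tensorIsometry_apply, map_map_assoc]
  exact ((TensorProduct.assocIsometry ℂ G D H).inner_map_map _ _).trans
    (TensorProduct.inner_tmul ..)

theorem evolve_embedState (J₀ J₁ : H →ₗᵢ[ℂ] V) (U : V ≃ₗᵢ[ℂ] V) (hU : ∀ h, U (J₀ h) = J₁ h)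
    (ρ : H →ₗ[ℂ] H) : evolve U (embedState J₀ ρ) = embedState J₁ ρ := by
  have h1 : LinearMap.adjoint J₀.toLinearMap ∘ₗ (U.symm.toLinearEquiv : V →ₗ[ℂ] V) =
      LinearMap.adjoint J₁.toLinearMap := by
    ext z
    refine ext_inner_left ℂ fun h => ?_
    rw [LinearMap.comp_apply, LinearMap.adjoint_inner_right, LinearMap.adjoint_inner_right]
    change inner ℂ (J₀ h) (U.symm z) = inner ℂ (J₁ h) z
    rw [← hU, ← U.inner_map_map, U.apply_symm_apply]
  ext z
  change U (J₀ (ρ ((LinearMap.adjoint J₀.toLinearMap ∘ₗ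
    (U.symm.toLinearEquiv : V →ₗ[ℂ] V)) z))) = _
  rw [h1, hU]
  rfl

theorem map_pure_eq_embedState [FiniteDimensional ℂ E] (e : E) (he : ‖e‖ = 1) (ρ : H →ₗ[ℂ] H) :
    TensorProduct.map ρ (DensityOperator.pure e he).op = embedState (tmulIsometry e he) ρ := by
  have h1 : ∀ (h : H) (f : E), LinearMap.adjoint (tmulIsometry (H := H) e he).toLinearMap
      (h ⊗ₜ f) = inner ℂ e f • h := by
    intro h f
    refine ext_inner_left ℂ fun h' => ?_
    rw [LinearMap.adjoint_inner_right]
    change inner ℂ (h' ⊗ₜ[ℂ] e) (h ⊗ₜ[ℂ] f) = _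
    rw [TensorProduct.inner_tmul, inner_smul_right, mul_comm]
  ext h f
  change ρ h ⊗ₜ[ℂ] (inner ℂ e f • e) =
    tmulIsometry e he (ρ (LinearMap.adjoint (tmulIsometry (H := H) e he).toLinearMap (h ⊗ₜ f)))
  rw [h1, map_smul, map_smul, TensorProduct.tmul_smul]
  rfl

theorem embedState_embedState {W : Type} [NormedAddCommGroup W] [InnerProductSpace ℂ W]
    [FiniteDimensional ℂ W] (J : H →ₗᵢ[ℂ] V) (J' : V →ₗᵢ[ℂ] W) (ρ : H →ₗ[ℂ] H) :
    embedState J' (embedState J ρ) = embedState (J'.comp J) ρ := by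
  have : LinearMap.adjoint (J'.comp J).toLinearMap =
      LinearMap.adjoint J.toLinearMap ∘ₗ LinearMap.adjoint J'.toLinearMap := by
    rw [← LinearMap.adjoint_comp]; rfl
  rw [embedState, embedState, embedState, this]
  rfl

end Tensor

/-! ### Disagreement of the two sides in an entangled pure state. -/

/-- For orthogonal projections both expressions expand to `‖Xz‖² + ‖Yz‖² - 2 Re ⟨z, XYz⟩`. Taking
real parts makes commutation of `X` and `Y` unnecessary. -/
theorem re_inner_disagreement {Z : Type} [NormedAddCommGroup Z] [InnerProductSpace ℂ Z]
    {X Y : Z →ₗ[ℂ] Z} (hX : X.IsSymmetric) (hX' : ∀ z, X (X z) = X z) (hY : Y.IsSymmetric)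
    (hY' : ∀ z, Y (Y z) = Y z) (z : Z) :
    (inner ℂ z (X (z - Y z)) + inner ℂ z (Y z - X (Y z))).re =
      ‖X z - Y z‖ ^ 2 := by
  have h1 : (inner ℂ z (X z)).re = ‖X z‖ ^ 2 := by
    rw [← hX' z, ← hX, hX' z]; exact inner_self_eq_norm_sq (𝕜 := ℂ) (X z)
  have h2 : (inner ℂ z (Y z)).re = ‖Y z‖ ^ 2 := by
    rw [← hY' z, ← hY, hY' z]; exact inner_self_eq_norm_sq (𝕜 := ℂ) (Y z)
  rw [norm_sub_sq (𝕜 := ℂ), ← h1, ← h2, hX]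
  simp only [map_sub, inner_sub_right, Complex.add_re, Complex.sub_re, RCLike.re_to_complex]
  ring

theorem TensorProduct.map_sub_left {R M N M' N' : Type*} [CommRing R] [AddCommGroup M]
    [AddCommGroup N] [AddCommGroup M'] [AddCommGroup N'] [Module R M] [Module R N] [Module R M']
    [Module R N'] (f f' : M →ₗ[R] M') (g : N →ₗ[R] N') :
    TensorProduct.map (f - f') g = TensorProduct.map f g - TensorProduct.map f' g :=
  TensorProduct.ext' fun x y => by simp [TensorProduct.sub_tmul]

theorem TensorProduct.map_sub_right {R M N M' N' : Type*} [CommRing R] [AddCommGroup M]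
    [AddCommGroup N] [AddCommGroup M'] [AddCommGroup N'] [Module R M] [Module R N] [Module R M']
    [Module R N'] (f : M →ₗ[R] M') (g g' : N →ₗ[R] N') :
    TensorProduct.map f (g - g') = TensorProduct.map f g - TensorProduct.map f g' :=
  TensorProduct.ext' fun x y => by simp [TensorProduct.tmul_sub]

section Correlation

variable {G D H : Type} [NormedAddCommGroup G] [InnerProductSpace ℂ G] [FiniteDimensional ℂ G]
  [NormedAddCommGroup D] [InnerProductSpace ℂ D] [FiniteDimensional ℂ D]
  [NormedAddCommGroup H] [InnerProductSpace ℂ H] [FiniteDimensional ℂ H]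
  {S : QuantumSystem.{u} (G ⊗[ℂ] (D ⊗[ℂ] H))}
  {m : OnticModel.{u, v} S} {L : LocalMeasurements S}

/-- The mean difference of the probabilities of the two sides, in terms of the entangled state `Ψ`
that determines the statistics of local measurements. -/
theorem OnticModel.ParameterIndependence.integral_abs_sub_le_norm_sq
    (hPI : m.ParameterIndependence L)
    {ν : Measure m.Λ} [IsProbabilityMeasure ν]
    {σ : G ⊗[ℂ] (D ⊗[ℂ] H) →ₗ[ℂ] G ⊗[ℂ] (D ⊗[ℂ] H)} (hν : m.ReproducesBorn ν σ) {Ψ : G ⊗[ℂ] D}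
    (hσ : ∀ (x : G →ₗ[ℂ] G) (y : D →ₗ[ℂ] D), LinearMap.trace ℂ (G ⊗[ℂ] (D ⊗[ℂ] H))
      (σ ∘ₗ TensorProduct.map x (TensorProduct.map y LinearMap.id)) =
        inner ℂ Ψ (TensorProduct.map x y Ψ))
    {M N : S.Meas} (hM : M ∈ L.first) (hN : N ∈ L.second) {A : Observable G} {B : Observable D}
    (hA : (S.obs M).op = TensorProduct.map A.op LinearMap.id)
    (hB : (S.obs N).op = TensorProduct.map LinearMap.id (B.tmulOne H).op)
    {a : ℝ} (ha : a ∈ (S.obs M).outcomes) {s : Finset ℝ} (hs : s ⊆ (S.obs N).outcomes) :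
    ∫ l, |m.prob M a l - ∑ b ∈ s, m.prob N b l| ∂ν ≤
      ‖TensorProduct.map (A.proj a) LinearMap.id Ψ -
        TensorProduct.map LinearMap.id (∑ b ∈ s, B.proj b) Ψ‖ ^ 2 := by
  classical
  refine (hPI.integral_abs_sub_le m L hν ⟨M, hM⟩ ⟨N, hN⟩ ha hs).trans_eq ?_
  set x := A.proj a
  set y := ∑ b ∈ s, B.proj b with hy
  have hys : y.IsSymmetric := by
    intro d d'
    simp only [hy, LinearMap.sum_apply, sum_inner, inner_sum, B.inner_proj_left]
  have hyy : ∀ d, y (y d) = y d := by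
    intro d
    simp only [hy, LinearMap.sum_apply, map_sum]
    refine Finset.sum_congr rfl fun b hb => ?_
    rw [Finset.sum_eq_single b]
    · exact B.proj_proj_apply b d
    · intro b' _ hb'
      exact B.proj_proj_of_ne hb' d
    · exact fun h => absurd hb h
  have hN' : ∑ b ∈ s, (S.obs N).proj b =
      TensorProduct.map LinearMap.id (TensorProduct.map y LinearMap.id) := by
    simp_rw [Observable.proj_of_op_eq_id_map hB, Observable.proj_of_op_eq_map_id
      (show (B.tmulOne H).op = TensorProduct.map B.op LinearMap.id from rfl)]
    simp only [hy, ← TensorProduct.mapBilinear_apply (R := ℂ), map_sum, LinearMap.sum_apply]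
  have hM' : (S.obs M).proj a = TensorProduct.map x (TensorProduct.map LinearMap.id LinearMap.id) := by
    rw [TensorProduct.map_id]
    exact Observable.proj_of_op_eq_map_id hA a
  have hop : ((S.obs M).proj a ∘ₗ (LinearMap.id - ∑ b ∈ s, (S.obs N).proj b) +
          (LinearMap.id - (S.obs M).proj a) ∘ₗ ∑ b ∈ s, (S.obs N).proj b) =
      TensorProduct.map x (TensorProduct.map (LinearMap.id - y) LinearMap.id) +
        TensorProduct.map (LinearMap.id - x) (TensorProduct.map y LinearMap.id) := by
    rw [hN', hM', TensorProduct.map_sub_left, TensorProduct.map_sub_left,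
      TensorProduct.map_sub_right, LinearMap.comp_sub, LinearMap.sub_comp]
    simp only [TensorProduct.map_id, ← TensorProduct.map_comp, LinearMap.comp_id,
      LinearMap.id_comp]
  have htr : LinearMap.trace ℂ (G ⊗[ℂ] (D ⊗[ℂ] H)) (σ ∘ₗ
      (TensorProduct.map x (TensorProduct.map (LinearMap.id - y) LinearMap.id) +
        TensorProduct.map (LinearMap.id - x) (TensorProduct.map y LinearMap.id))) =
      inner ℂ Ψ (TensorProduct.map x (LinearMap.id - y) Ψ) +
        inner ℂ Ψ (TensorProduct.map (LinearMap.id - x) y Ψ) := by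
    rw [LinearMap.comp_add, map_add, hσ, hσ]
  have hmain := re_inner_disagreement (Z := G ⊗[ℂ] D) (X := TensorProduct.map x LinearMap.id)
    (Y := TensorProduct.map LinearMap.id y)
    (isSymmetric_map (A.proj_isSymmetric a) LinearMap.IsSymmetric.id)
    (fun z => by
      rw [← LinearMap.comp_apply, ← TensorProduct.map_comp]
      congr 2
      ext g
      exact A.proj_proj_apply a g)
    (isSymmetric_map LinearMap.IsSymmetric.id hys)
    (fun z => by
      rw [← LinearMap.comp_apply, ← TensorProduct.map_comp]
      congr 2
      ext d
      exact hyy d) Ψ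
  rw [← hmain]
  refine congrArg Complex.re (Eq.trans ?_ (htr.trans ?_))
  · exact congrArg (fun f => LinearMap.trace ℂ (G ⊗[ℂ] (D ⊗[ℂ] H)) (σ ∘ₗ f)) hop
  · rw [TensorProduct.map_sub_left, TensorProduct.map_sub_right, LinearMap.sub_apply,
      LinearMap.sub_apply, map_sub, ← LinearMap.comp_apply,
      ← TensorProduct.map_comp, LinearMap.comp_id, LinearMap.id_comp]

end Correlation

theorem nontrivial_of_norm_eq_one {G : Type*} [NormedAddCommGroup G] {x : G} (hx : ‖x‖ = 1) :
    Nontrivial G :=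
  ⟨x, 0, fun h => by simp [h] at hx⟩

/-! ### Plane rotations and Schmidt vectors. -/

section Rotation

variable {G D : Type} [NormedAddCommGroup G] [InnerProductSpace ℂ G]
  [NormedAddCommGroup D] [InnerProductSpace ℂ D]

theorem norm_eq_one_iff_inner_self {x : G} : ‖x‖ = 1 ↔ inner ℂ x x = (1 : ℂ) := by
  constructor
  · intro h
    rw [inner_self_eq_norm_sq_to_K, h]; simp
  · intro h
    have h1 := inner_self_eq_norm_sq (𝕜 := ℂ) x
    rw [h, RCLike.one_re] at h1
    exact (pow_eq_one_iff_of_nonneg (norm_nonneg _) two_ne_zero).1 h1.symm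

theorem norm_sum_smul_eq_one {ι : Type*} [Fintype ι] {g : ι → G} (hg : Orthonormal ℂ g)
    {α : ι → ℝ} (hα : ∑ i, α i ^ 2 = 1) : ‖∑ i, (α i : ℂ) • g i‖ = 1 := by
  rw [norm_eq_one_iff_inner_self, hg.inner_sum, ← Complex.ofReal_one, ← hα]
  simp [sq]

/-- The rotation by the angle `t` in the plane of `p` and `q`. -/
def rotated (p q : G) (t : ℝ) : G := (Real.cos t : ℂ) • p + (Real.sin t : ℂ) • q

theorem rotated_zero (p q : G) : rotated p q 0 = p := by simp [rotated]

theorem rotated_pi_div_two (p q : G) : rotated p q (Real.pi / 2) = q := by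
  simp only [rotated, Real.cos_pi_div_two, Real.sin_pi_div_two]; simp

theorem inner_rotated {p q : G} (hp : ‖p‖ = 1) (hq : ‖q‖ = 1) (hpq : inner ℂ p q = 0) (s t : ℝ) :
    inner ℂ (rotated p q s) (rotated p q t) = (Real.cos (s - t) : ℂ) := by
  have hqp : inner ℂ q p = 0 := inner_eq_zero_symm.1 hpq
  have hpp : inner ℂ p p = (1 : ℂ) := by rw [inner_self_eq_norm_sq_to_K, hp]; simp
  have hqq : inner ℂ q q = (1 : ℂ) := by rw [inner_self_eq_norm_sq_to_K, hq]; simp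
  simp only [rotated, inner_add_left, inner_add_right, inner_smul_left, inner_smul_right, hpq, hqp,
    hpp, hqq, Complex.conj_ofReal, Real.cos_sub]
  push_cast
  ring

theorem norm_rotated {p q : G} (hp : ‖p‖ = 1) (hq : ‖q‖ = 1) (hpq : inner ℂ p q = 0) (t : ℝ) :
    ‖rotated p q t‖ = 1 := by
  rw [norm_eq_one_iff_inner_self, inner_rotated hp hq hpq, sub_self, Real.cos_zero,
    Complex.ofReal_one]

/-- The two unit vectors have inner product `cos² (s - t)`, so the left side is `2 sin² (s - t)`.
That the bound is quadratic in the angle is what lets a chain of many small rotations have a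
vanishing total cost. -/
theorem norm_sq_rotated_tmul_sub_le {p q : G} (hp : ‖p‖ = 1) (hq : ‖q‖ = 1)
    (hpq : inner ℂ p q = 0) {p' q' : D} (hp' : ‖p'‖ = 1) (hq' : ‖q'‖ = 1)
    (hpq' : inner ℂ p' q' = 0) (s t : ℝ) :
    ‖rotated p q s ⊗ₜ[ℂ] rotated p' q' s - rotated p q t ⊗ₜ[ℂ] rotated p' q' t‖ ^ 2 ≤
      2 * (s - t) ^ 2 := by
  rw [norm_sub_sq (𝕜 := ℂ), TensorProduct.norm_tmul, TensorProduct.norm_tmul,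
    TensorProduct.inner_tmul, inner_rotated hp hq hpq, inner_rotated hp' hq' hpq',
    norm_rotated hp hq hpq, norm_rotated hp hq hpq, norm_rotated hp' hq' hpq',
    norm_rotated hp' hq' hpq', ← Complex.ofReal_mul, RCLike.re_to_complex, Complex.ofReal_re]
  have h1 := Real.sin_sq_add_cos_sq (s - t)
  have h2 : Real.sin (s - t) ^ 2 ≤ (s - t) ^ 2 := sq_le_sq.2 Real.abs_sin_le_abs
  nlinarith

variable {ι : Type} [Fintype ι]

/-- The vector with Schmidt coefficients `α` with respect to the given families. -/
def schmidtVector (g : ι → G) (d : ι → D) (α : ι → ℝ) : G ⊗[ℂ] D :=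
  ∑ i, (α i : ℂ) • (g i ⊗ₜ[ℂ] d i)

theorem norm_schmidtVector {g : ι → G} {d : ι → D} (hg : Orthonormal ℂ g) (hd : Orthonormal ℂ d)
    {α : ι → ℝ} (hα : ∑ i, α i ^ 2 = 1) : ‖schmidtVector g d α‖ = 1 := by
  exact norm_sum_smul_eq_one ((hg.tmul hd).comp (fun i => (i, i))
    fun i j h => congrArg Prod.fst h) hα

/-- Contracting the Schmidt vector with a rotated `g` gives the equally rotated `d`. This needs `α i
= α j`, and real rotation coefficients so that conjugation does no harm. -/
theorem sum_inner_rotated_smul {g : ι → G} {d : ι → D} (hg : Orthonormal ℂ g) (α : ι → ℝ)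
    {i j : ι} (hij : α i = α j) (t : ℝ) :
    ∑ k, ((α k : ℂ) * inner ℂ (rotated (g i) (g j) t) (g k)) • d k =
      (α i : ℂ) • rotated (d i) (d j) t := by
  classical
  simp only [rotated, inner_add_left, inner_smul_left, Complex.conj_ofReal,
    orthonormal_iff_ite.1 hg, mul_add, add_smul, Finset.sum_add_distrib, mul_ite, mul_one,
    mul_zero, ite_smul, zero_smul, Finset.sum_ite_eq, Finset.mem_univ, if_true, smul_add,
    smul_smul, hij]

theorem map_rotated_left_schmidtVector {g : ι → G} {d : ι → D} (hg : Orthonormal ℂ g) {α : ι → ℝ}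
    {i j : ι} (hij : α i = α j) (t : ℝ) {x : G →ₗ[ℂ] G}
    (hx : ∀ z, x z = inner ℂ (rotated (g i) (g j) t) z • rotated (g i) (g j) t) :
    TensorProduct.map x LinearMap.id (schmidtVector g d α) =
      (α i : ℂ) • (rotated (g i) (g j) t ⊗ₜ[ℂ] rotated (d i) (d j) t) := by
  rw [← TensorProduct.tmul_smul, ← sum_inner_rotated_smul hg α hij, TensorProduct.tmul_sum,
    schmidtVector, map_sum]
  refine Finset.sum_congr rfl fun k _ => ?_
  rw [map_smul, TensorProduct.map_tmul, hx, LinearMap.id_apply, TensorProduct.smul_tmul,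
    ← TensorProduct.tmul_smul, smul_smul]

/-- The result is the vector that the projection on the left side yields, so lines rotated by the
same angle are perfectly correlated. The indices may coincide; with angle 0 this treats a single
Schmidt line. -/
theorem map_rotated_right_schmidtVector {g : ι → G} {d : ι → D} (hd : Orthonormal ℂ d) {α : ι → ℝ}
    {i j : ι} (hij : α i = α j) (t : ℝ) {y : D →ₗ[ℂ] D}
    (hy : ∀ z, y z = inner ℂ (rotated (d i) (d j) t) z • rotated (d i) (d j) t) :
    TensorProduct.map LinearMap.id y (schmidtVector g d α) =
      (α i : ℂ) • (rotated (g i) (g j) t ⊗ₜ[ℂ] rotated (d i) (d j) t) := by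
  rw [TensorProduct.smul_tmul', ← sum_inner_rotated_smul hd α hij, TensorProduct.sum_tmul,
    schmidtVector, map_sum]
  refine Finset.sum_congr rfl fun k _ => ?_
  rw [map_smul, TensorProduct.map_tmul, hy, LinearMap.id_apply, ← TensorProduct.smul_tmul,
    TensorProduct.smul_tmul', smul_smul]

theorem linearMap_id_ne_zero [Nontrivial G] : (LinearMap.id : G →ₗ[ℂ] G) ≠ 0 := one_ne_zero

theorem Observable.ofUnit_proj_ne_zero [FiniteDimensional ℂ G] {v : G} (hv : ‖v‖ = 1) :
    (Observable.ofUnit v).proj 1 ≠ 0 := by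
  intro h
  have h1 := Observable.ofUnit_proj_apply hv v
  rw [h, norm_eq_one_iff_inner_self.1 hv, one_smul, LinearMap.zero_apply] at h1
  simp [← h1] at hv

theorem TensorProduct.map_ne_zero {G' D' : Type} [NormedAddCommGroup G'] [InnerProductSpace ℂ G']
    [NormedAddCommGroup D'] [InnerProductSpace ℂ D'] {f : G →ₗ[ℂ] G'} {k : D →ₗ[ℂ] D'}
    (hf : f ≠ 0) (hk : k ≠ 0) : TensorProduct.map f k ≠ 0 := by
  obtain ⟨x, hx⟩ : ∃ x, f x ≠ 0 := by
    by_contra! h; exact hf (LinearMap.ext h)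
  obtain ⟨y, hy⟩ : ∃ y, k y ≠ 0 := by
    by_contra! h; exact hk (LinearMap.ext h)
  intro h
  have h1 := TensorProduct.norm_tmul (𝕜 := ℂ) (f x) (k y)
  rw [← TensorProduct.map_tmul, h, LinearMap.zero_apply, norm_zero] at h1
  exact mul_ne_zero (norm_ne_zero_iff.2 hx) (norm_ne_zero_iff.2 hy) h1.symm

end Rotation

/-! ### Equal Schmidt coefficients give equal probabilities. -/

section Chain

variable {G D H : Type} [NormedAddCommGroup G] [InnerProductSpace ℂ G] [FiniteDimensional ℂ G]
  [NormedAddCommGroup D] [InnerProductSpace ℂ D] [FiniteDimensional ℂ D]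
  [NormedAddCommGroup H] [InnerProductSpace ℂ H] [FiniteDimensional ℂ H]
  {S : QuantumSystem.{u} (G ⊗[ℂ] (D ⊗[ℂ] H))}
  {m : OnticModel.{u, v} S} {L : LocalMeasurements S}

theorem LocalMeasurements.mem_outcomes_first {M : S.Meas} [Nontrivial D] [Nontrivial H]
    {A : Observable G} (hA : (S.obs M).op = TensorProduct.map A.op LinearMap.id) {a : ℝ}
    (ha : A.proj a ≠ 0) : a ∈ (S.obs M).outcomes := by
  rw [Observable.mem_outcomes_iff, Observable.proj_of_op_eq_map_id hA]
  have : Nontrivial (D ⊗[ℂ] H) := nontrivial_tensorProduct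
  exact TensorProduct.map_ne_zero ha linearMap_id_ne_zero

theorem LocalMeasurements.mem_outcomes_second {N : S.Meas} [Nontrivial G] [Nontrivial H]
    {B : Observable D} (hB : (S.obs N).op = TensorProduct.map LinearMap.id (B.tmulOne H).op)
    {b : ℝ} (hb : B.proj b ≠ 0) : b ∈ (S.obs N).outcomes := by
  rw [Observable.mem_outcomes_iff, Observable.proj_of_op_eq_id_map hB,
    Observable.proj_of_op_eq_map_id (show (B.tmulOne H).op = _ from rfl)]
  exact TensorProduct.map_ne_zero linearMap_id_ne_zero
    (TensorProduct.map_ne_zero hb linearMap_id_ne_zero)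

/-- The outcome `b` of the measurement `N` on the second side is represented by the projection
onto the line of `v`. -/
def LocalMeasurements.IsLineOutcome (L : LocalMeasurements S) (v : D) (N : S.Meas) (b : ℝ) :
    Prop :=
  N ∈ L.second ∧ b ∈ (S.obs N).outcomes ∧ ∃ B : Observable D,
    (S.obs N).op = TensorProduct.map LinearMap.id (B.tmulOne H).op ∧
      ∀ d, B.proj b d = inner ℂ v d • v

theorem LocalMeasurements.exists_isLineOutcome [Nontrivial G] [Nontrivial H]
    (L : LocalMeasurements S) {v : D} (hv : ‖v‖ = 1) : ∃ N, L.IsLineOutcome v N 1 := by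
  obtain ⟨N, hN, hop⟩ := L.second_onto ((Observable.ofUnit v).tmulOne H)
  exact ⟨N, hN, mem_outcomes_second hop (Observable.ofUnit_proj_ne_zero hv), _, hop,
    Observable.ofUnit_proj_apply hv⟩

variable [Nontrivial H] {ι : Type} [Fintype ι] {g : ι → G} {d : ι → D} {α : ι → ℝ}
  {ν : Measure m.Λ} [IsProbabilityMeasure ν] {σ : G ⊗[ℂ] (D ⊗[ℂ] H) →ₗ[ℂ] G ⊗[ℂ] (D ⊗[ℂ] H)}

/-- Both outcomes on the second side are compared with one outcome on the first side, the line
rotated by the angle `s`. It is perfectly correlated with `N` and nearly so with `N'`; parameter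
independence keeps its probability the same in both comparisons. -/
theorem OnticModel.ParameterIndependence.integral_abs_sub_rotated_le
    (hPI : m.ParameterIndependence L) (hν : m.ReproducesBorn ν σ)
    (hg : Orthonormal ℂ g) (hd : Orthonormal ℂ d)
    (hσ : ∀ (x : G →ₗ[ℂ] G) (y : D →ₗ[ℂ] D), LinearMap.trace ℂ (G ⊗[ℂ] (D ⊗[ℂ] H))
      (σ ∘ₗ TensorProduct.map x (TensorProduct.map y LinearMap.id)) =
        inner ℂ (schmidtVector g d α) (TensorProduct.map x y (schmidtVector g d α)))
    {i j : ι} (hij : i ≠ j) (hα : α i = α j) {s t : ℝ} {N N' : S.Meas} {b b' : ℝ}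
    (hN : L.IsLineOutcome (rotated (d i) (d j) s) N b)
    (hN' : L.IsLineOutcome (rotated (d i) (d j) t) N' b') :
    ∫ l, |m.prob N b l - m.prob N' b' l| ∂ν ≤ α i ^ 2 * (2 * (s - t) ^ 2) := by
  have hn := norm_rotated (hg.1 i) (hg.1 j) (hg.2 hij) s
  have : Nontrivial D := nontrivial_of_norm_eq_one (hd.1 i)
  obtain ⟨M, hM, hA⟩ := L.first_onto (Observable.ofUnit (rotated (g i) (g j) s))
  have hx := Observable.ofUnit_proj_apply hn
  have h1 : (1 : ℝ) ∈ (S.obs M).outcomes :=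
    LocalMeasurements.mem_outcomes_first hA (Observable.ofUnit_proj_ne_zero hn)
  have key : ∀ (t : ℝ) (N : S.Meas) (b : ℝ), L.IsLineOutcome (rotated (d i) (d j) t) N b →
      ∫ l, |m.prob M 1 l - m.prob N b l| ∂ν ≤ α i ^ 2 * (2 * (s - t) ^ 2) := by
    rintro t N b ⟨hNs, hb, B, hB, hy⟩
    have h2 := hPI.integral_abs_sub_le_norm_sq hν hσ hM hNs hA hB h1
      (Finset.singleton_subset_iff.2 hb)
    simp only [Finset.sum_singleton] at h2
    rw [map_rotated_left_schmidtVector hg hα s hx, map_rotated_right_schmidtVector hd hα t hy,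
      ← smul_sub, norm_smul, mul_pow, Complex.norm_real, Real.norm_eq_abs, sq_abs] at h2
    exact h2.trans (mul_le_mul_of_nonneg_left (norm_sq_rotated_tmul_sub_le (hg.1 i) (hg.1 j)
      (hg.2 hij) (hd.1 i) (hd.1 j) (hd.2 hij) s t) (sq_nonneg _))
  have hi : ∀ N b, Integrable (fun l => |m.prob M 1 l - m.prob N b l|) ν := fun N b =>
    ((m.integrable_prob ν M 1).sub (m.integrable_prob ν N b)).abs
  calc ∫ l, |m.prob N b l - m.prob N' b' l| ∂ν
      ≤ ∫ l, (|m.prob M 1 l - m.prob N b l| + |m.prob M 1 l - m.prob N' b' l|) ∂ν := by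
        refine integral_mono ((m.integrable_prob ν N b).sub (m.integrable_prob ν N' b')).abs
          ((hi N b).add (hi N' b')) fun l => ?_
        have := abs_sub_le (m.prob N b l) (m.prob M 1 l) (m.prob N' b' l)
        rwa [abs_sub_comm (m.prob N b l) (m.prob M 1 l)] at this
    _ = ∫ l, |m.prob M 1 l - m.prob N b l| ∂ν + ∫ l, |m.prob M 1 l - m.prob N' b' l| ∂ν :=
        integral_add (hi N b) (hi N' b')
    _ ≤ α i ^ 2 * (2 * (s - s) ^ 2) + α i ^ 2 * (2 * (s - t) ^ 2) :=
        add_le_add (key s N b hN) (key t N' b' hN')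
    _ = α i ^ 2 * (2 * (s - t) ^ 2) := by ring

/-- Outcomes on the second side that correspond to equal Schmidt coefficients have the same
probability in almost every ontic state, by a chain of ever finer rotations. -/
theorem OnticModel.ParameterIndependence.ae_prob_eq
    (hPI : m.ParameterIndependence L) (hν : m.ReproducesBorn ν σ)
    (hg : Orthonormal ℂ g) (hd : Orthonormal ℂ d)
    (hσ : ∀ (x : G →ₗ[ℂ] G) (y : D →ₗ[ℂ] D), LinearMap.trace ℂ (G ⊗[ℂ] (D ⊗[ℂ] H))
      (σ ∘ₗ TensorProduct.map x (TensorProduct.map y LinearMap.id)) =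
        inner ℂ (schmidtVector g d α) (TensorProduct.map x y (schmidtVector g d α)))
    {i j : ι} (hij : i ≠ j) (hα : α i = α j) {N N' : S.Meas} {b b' : ℝ}
    (hN : L.IsLineOutcome (d i) N b) (hN' : L.IsLineOutcome (d j) N' b') :
    ∀ᵐ l ∂ν, m.prob N b l = m.prob N' b' l := by
  have : Nontrivial G := nontrivial_of_norm_eq_one (hg.1 i)
  rw [← rotated_zero (d i) (d j)] at hN
  rw [← rotated_pi_div_two (d i) (d j)] at hN'
  have hint : ∀ N N' b b', Integrable (fun l => |m.prob N b l - m.prob N' b' l|) ν :=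
    fun N N' b b' => ((m.integrable_prob ν N b).sub (m.integrable_prob ν N' b')).abs
  -- Each rotation by `h` costs `α i ^ 2 * (2 * h ^ 2)`, and the costs add up by the triangle
  -- inequality. The intermediate measurement may be any that has the rotated line as an outcome.
  have chain : ∀ (h : ℝ) (k : ℕ) (N' : S.Meas) (b' : ℝ),
      L.IsLineOutcome (rotated (d i) (d j) (k * h)) N' b' →
      ∫ l, |m.prob N b l - m.prob N' b' l| ∂ν ≤ k * (α i ^ 2 * (2 * h ^ 2)) := by
    intro h k
    induction k with
    | zero =>
      intro N' b' hN'
      refine (hPI.integral_abs_sub_rotated_le hν hg hd hσ hij hα hN hN').trans_eq ?_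
      simp
    | succ k ih =>
      intro N' b' hN'
      obtain ⟨N₁, hN₁⟩ := L.exists_isLineOutcome
        (norm_rotated (hd.1 i) (hd.1 j) (hd.2 hij) (k * h))
      have h1 := ih N₁ 1 hN₁
      have h2 := hPI.integral_abs_sub_rotated_le hν hg hd hσ hij hα hN₁ hN'
      calc ∫ l, |m.prob N b l - m.prob N' b' l| ∂ν
          ≤ ∫ l, (|m.prob N b l - m.prob N₁ 1 l| + |m.prob N₁ 1 l - m.prob N' b' l|) ∂ν :=
            integral_mono (hint _ _ _ _) ((hint _ _ _ _).add (hint _ _ _ _))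
              fun l => abs_sub_le _ _ _
        _ = ∫ l, |m.prob N b l - m.prob N₁ 1 l| ∂ν + ∫ l, |m.prob N₁ 1 l - m.prob N' b' l| ∂ν :=
            integral_add (hint _ _ _ _) (hint _ _ _ _)
        _ ≤ _ := add_le_add h1 h2
        _ = _ := by push_cast; ring
  have hle : ∫ l, |m.prob N b l - m.prob N' b' l| ∂ν ≤ 0 := by
    -- The quarter turn in `n` steps of angle `π / (2n)` costs `n * α² * 2 * (π / (2n))² = α² π² /
    -- (2n)`.
    have hlim : Filter.Tendsto (fun n : ℕ => α i ^ 2 * Real.pi ^ 2 / 2 / (n : ℝ)) Filter.atTop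
        (nhds 0) := tendsto_const_div_atTop_nhds_zero_nat _
    refine ge_of_tendsto hlim ?_
    filter_upwards [Filter.eventually_gt_atTop 0] with n hn
    have hn' : (n : ℝ) ≠ 0 := Nat.cast_ne_zero.2 hn.ne'
    have h1 := chain (Real.pi / 2 / n) n N' b' (by rwa [mul_div_cancel₀ _ hn'])
    refine h1.trans_eq ?_
    field_simp
  have h0 : ∫ l, |m.prob N b l - m.prob N' b' l| ∂ν = 0 :=
    le_antisymm hle (integral_nonneg fun l => abs_nonneg _)
  rw [integral_eq_zero_iff_of_nonneg (fun l => abs_nonneg _) (hint _ _ _ _)] at h0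
  filter_upwards [h0] with l hl
  exact sub_eq_zero.1 (abs_eq_zero.1 hl)

end Chain

/-! ### Counting cells of equal weight. -/

section Cells

variable {G D H : Type} [NormedAddCommGroup G] [InnerProductSpace ℂ G]
  [NormedAddCommGroup D] [InnerProductSpace ℂ D] [NormedAddCommGroup H] [InnerProductSpace ℂ H]
  {ι : Type} [Fintype ι] {g : ι → G} {α : ι → ℝ}

theorem inner_schmidtVector_tmul (hg : Orthonormal ℂ g) {d : ι → D} (hd : Orthonormal ℂ d)
    (i : ι) : inner ℂ (schmidtVector g d α) (g i ⊗ₜ[ℂ] d i) = (α i : ℂ) := by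
  have h := (hg.tmul hd).comp (fun i => (i, i)) fun i j h => congrArg Prod.fst h
  exact (h.inner_left_fintype (fun i => (α i : ℂ)) i).trans (Complex.conj_ofReal _)

theorem map_line_schmidtVector {d : ι → D} (hd : Orthonormal ℂ d) (i : ι) {y : D →ₗ[ℂ] D}
    (hy : ∀ z, y z = inner ℂ (d i) z • d i) :
    TensorProduct.map LinearMap.id y (schmidtVector g d α) = (α i : ℂ) • (g i ⊗ₜ[ℂ] d i) := by
  have h := map_rotated_right_schmidtVector (g := g) (α := α) hd (i := i) (j := i) rfl 0 (y := y)
  simp only [rotated_zero] at h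
  exact h hy

theorem map_left_schmidtVector {d : ι → D} (s : Finset ι) {x : G →ₗ[ℂ] G}
    (hx : ∀ i ∈ s, x (g i) = g i) (hx' : ∀ i ∉ s, x (g i) = 0) :
    TensorProduct.map x LinearMap.id (schmidtVector g d α) =
      ∑ i ∈ s, (α i : ℂ) • (g i ⊗ₜ[ℂ] d i) := by
  classical
  rw [schmidtVector, map_sum, ← Finset.sum_subset (Finset.subset_univ s)]
  · refine Finset.sum_congr rfl fun i hi => ?_
    rw [map_smul, TensorProduct.map_tmul, hx i hi, LinearMap.id_apply]
  · intro i _ hi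
    rw [map_smul, TensorProduct.map_tmul, hx' i hi, TensorProduct.zero_tmul, smul_zero]

theorem inner_map_left_schmidtVector (hg : Orthonormal ℂ g) {d : ι → D} (hd : Orthonormal ℂ d)
    (s : Finset ι) {x : G →ₗ[ℂ] G} (hx : ∀ i ∈ s, x (g i) = g i) (hx' : ∀ i ∉ s, x (g i) = 0) :
    inner ℂ (schmidtVector g d α) (TensorProduct.map x LinearMap.id (schmidtVector g d α)) =
      ((∑ i ∈ s, α i ^ 2 : ℝ) : ℂ) := by
  rw [map_left_schmidtVector s hx hx', Complex.ofReal_sum]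
  refine (inner_sum (E := G ⊗[ℂ] D) _ _ _).trans (Finset.sum_congr rfl fun i _ => ?_)
  refine (inner_smul_right (E := G ⊗[ℂ] D) _ _ _).trans ?_
  rw [inner_schmidtVector_tmul hg hd]
  push_cast
  ring

variable [FiniteDimensional ℂ G] [FiniteDimensional ℂ D] [FiniteDimensional ℂ H]
  {S : QuantumSystem.{u} (G ⊗[ℂ] (D ⊗[ℂ] H))}
  {m : OnticModel.{u, v} S} {L : LocalMeasurements S} [Nontrivial H]
  {ν : Measure m.Λ} [IsProbabilityMeasure ν] {σ : G ⊗[ℂ] (D ⊗[ℂ] H) →ₗ[ℂ] G ⊗[ℂ] (D ⊗[ℂ] H)}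

/-- If the eigenspace for the outcome `a` and its complement are refined into cells, then cells of
equal weight force the probability of `a` to be close to its Born value. -/
theorem OnticModel.ParameterIndependence.integral_abs_cells_le
    (hPI : m.ParameterIndependence L) (hν : m.ReproducesBorn ν σ)
    (hg : Orthonormal ℂ g) (d : OrthonormalBasis ι ℂ D)
    (hσ : ∀ (x : G →ₗ[ℂ] G) (y : D →ₗ[ℂ] D), LinearMap.trace ℂ (G ⊗[ℂ] (D ⊗[ℂ] H))
      (σ ∘ₗ TensorProduct.map x (TensorProduct.map y LinearMap.id)) =
        inner ℂ (schmidtVector g d α) (TensorProduct.map x y (schmidtVector g d α)))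
    {M : S.Meas} (hM : M ∈ L.first) {A : Observable G}
    (hA : (S.obs M).op = TensorProduct.map A.op LinearMap.id) {a : ℝ}
    (ha : a ∈ (S.obs M).outcomes) {s s₀ s₁ : Finset ι}
    (hs : ∀ i ∈ s, A.proj a (g i) = g i) (hs' : ∀ i ∉ s, A.proj a (g i) = 0)
    (h₀ : s₀ ⊆ s) (h₁ : Disjoint s s₁) (hα : ∀ i ∈ s₀, ∀ j ∈ s₁, α i = α j) :
    ∫ l, |(s₁.card : ℝ) * m.prob M a l - s₀.card * (1 - m.prob M a l)| ∂ν ≤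
      s₁.card * (∑ i ∈ s, α i ^ 2 - ∑ i ∈ s₀, α i ^ 2) +
        s₀.card * (1 - ∑ i ∈ s, α i ^ 2 - ∑ i ∈ s₁, α i ^ 2) := by
  classical
  by_cases hι : IsEmpty ι
  · have e0 : s₀ = ∅ := Finset.eq_empty_of_isEmpty _
    have e1 : s₁ = ∅ := Finset.eq_empty_of_isEmpty _
    simp [e0, e1]
  obtain ⟨i₀⟩ := not_isEmpty_iff.1 hι
  have : Nontrivial G := nontrivial_of_norm_eq_one (hg.1 i₀)
  -- Only distinctness of the eigenvalues matters: a single measurement `N` has all the basis lines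
  -- as separate outcomes.
  let β : ι → ℝ := fun i => ((Fintype.equivFin ι i : ℕ) : ℝ)
  have hβ : Function.Injective β := fun i j h =>
    (Fintype.equivFin ι).injective (Fin.ext (Nat.cast_injective h))
  obtain ⟨N, hN, hB⟩ := L.second_onto ((Observable.diagonal d β).tmulOne H)
  have hproj := Observable.diagonal_proj_apply d hβ
  have hline : ∀ i, L.IsLineOutcome (d i) N (β i) := by
    refine fun i => ⟨hN, LocalMeasurements.mem_outcomes_second hB fun h => ?_, _, hB, hproj i⟩
    have h1 := hproj i (d i)
    rw [h, norm_eq_one_iff_inner_self.1 (d.orthonormal.1 i), one_smul, LinearMap.zero_apply] at h1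
    have h2 := d.orthonormal.1 i
    simp [← h1] at h2
  set q : ι → m.Λ → ℝ := fun i => m.prob N (β i) with hq
  have hqi : ∀ i, Integrable (q i) ν := fun i => m.integrable_prob ν N _
  have hqint : ∀ i, ∫ l, q i l ∂ν = α i ^ 2 := by
    intro i
    rw [hq]
    refine (hν N (β i)).trans ?_
    have h1 : (S.obs N).proj (β i) = TensorProduct.map LinearMap.id
        (TensorProduct.map ((Observable.diagonal d β).proj (β i)) LinearMap.id) := by
      rw [Observable.proj_of_op_eq_id_map hB, Observable.proj_of_op_eq_map_id
        (show ((Observable.diagonal d β).tmulOne H).op = _ from rfl)]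
    rw [bornProb, h1]
    refine (congrArg Complex.re (hσ _ _)).trans ?_
    rw [map_line_schmidtVector d.orthonormal i (hproj i)]
    refine (congrArg Complex.re (inner_smul_right (E := G ⊗[ℂ] D) _ _ _)).trans ?_
    rw [inner_schmidtVector_tmul hg d.orthonormal, ← Complex.ofReal_mul, Complex.ofReal_re, sq]
  -- The outcome `a` and the set of outcomes in `s` are perfectly correlated: both projections send
  -- the Schmidt vector to its part over `s`, so the bound on the mean difference is zero.
  have hsum : ∀ᵐ l ∂ν, m.prob M a l = ∑ i ∈ s, q i l := by
    have h1 := hPI.integral_abs_sub_le_norm_sq hν hσ hM hN hA hB ha (s := s.image β) (by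
      intro b hb
      obtain ⟨i, _, rfl⟩ := Finset.mem_image.1 hb
      exact (hline i).2.1)
    have h2 : TensorProduct.map LinearMap.id
        (∑ b ∈ s.image β, (Observable.diagonal d β).proj b) (schmidtVector g d α) =
        ∑ i ∈ s, (α i : ℂ) • (g i ⊗ₜ[ℂ] d i) := by
      rw [Finset.sum_image hβ.injOn]
      simp only [← TensorProduct.mapBilinear_apply (R := ℂ), map_sum, LinearMap.sum_apply]
      refine Finset.sum_congr rfl fun i _ => ?_
      exact map_line_schmidtVector d.orthonormal i (hproj i)
    rw [map_left_schmidtVector s hs hs', h2, sub_self, norm_zero, zero_pow two_ne_zero] at h1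
    have hint : Integrable (fun l => |m.prob M a l - ∑ b ∈ s.image β, m.prob N b l|) ν :=
      ((m.integrable_prob ν M a).sub
        (integrable_finsetSum _ fun b _ => m.integrable_prob ν N b)).abs
    have h0 := le_antisymm h1 (integral_nonneg fun l => abs_nonneg _)
    rw [integral_eq_zero_iff_of_nonneg (fun l => abs_nonneg _) hint] at h0
    filter_upwards [h0] with l hl
    rw [sub_eq_zero.1 (abs_eq_zero.1 hl), Finset.sum_image hβ.injOn]
  have hcell : ∀ᵐ l ∂ν, ∀ i ∈ s₀, ∀ j ∈ s₁, q i l = q j l := by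
    refine (ae_ball_iff s₀.countable_toSet).2 fun i hi => ?_
    refine (ae_ball_iff s₁.countable_toSet).2 fun j hj => ?_
    have hij : i ≠ j := fun h => Finset.disjoint_left.1 h₁ (h₀ hi) (h ▸ hj)
    exact hPI.ae_prob_eq hν hg d.orthonormal hσ hij (hα i hi j hj) (hline i) (hline j)
  have hsi : ∀ t : Finset ι, Integrable (fun l => ∑ i ∈ t, q i l) ν := fun t =>
    integrable_finsetSum _ fun i _ => hqi i
  have hsint : ∀ t : Finset ι, ∫ l, ∑ i ∈ t, q i l ∂ν = ∑ i ∈ t, α i ^ 2 := fun t => by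
    rw [integral_finsetSum _ fun i _ => hqi i]
    exact Finset.sum_congr rfl fun i _ => hqint i
  have hpt : ∀ᵐ l ∂ν, |(s₁.card : ℝ) * m.prob M a l - s₀.card * (1 - m.prob M a l)| ≤
      s₁.card * (∑ i ∈ s, q i l - ∑ i ∈ s₀, q i l) +
        s₀.card * (1 - ∑ i ∈ s, q i l - ∑ i ∈ s₁, q i l) := by
    filter_upwards [hsum, hcell] with l hl hc
    -- Both sides are the double sum over `s₀ × s₁`, by equality of the cell probabilities.
    have e1 : (s₁.card : ℝ) * ∑ i ∈ s₀, q i l = s₀.card * ∑ j ∈ s₁, q j l := by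
      have h2 : ∑ i ∈ s₀, ∑ j ∈ s₁, q i l = ∑ i ∈ s₀, ∑ j ∈ s₁, q j l :=
        Finset.sum_congr rfl fun i hi => Finset.sum_congr rfl fun j hj => hc i hi j hj
      simpa [Finset.mul_sum] using h2
    have e2 : 0 ≤ ∑ i ∈ s, q i l - ∑ i ∈ s₀, q i l := sub_nonneg.2
      (Finset.sum_le_sum_of_subset_of_nonneg h₀ fun i _ _ => m.prob_nonneg N _ l)
    have e3 : 0 ≤ 1 - ∑ i ∈ s, q i l - ∑ i ∈ s₁, q i l := by
      have h2 := m.sum_prob_le_one N ((s ∪ s₁).image β) l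
      rw [Finset.sum_image hβ.injOn, Finset.sum_union h₁] at h2
      linarith
    rw [hl]
    -- The cells cancel by `e1`. Only the two nonnegative remainders are left, and their means are
    -- known from the Born rule.
    have e4 : (s₁.card : ℝ) * ∑ i ∈ s, q i l - s₀.card * (1 - ∑ i ∈ s, q i l) =
        s₁.card * (∑ i ∈ s, q i l - ∑ i ∈ s₀, q i l) -
          s₀.card * (1 - ∑ i ∈ s, q i l - ∑ i ∈ s₁, q i l) := by
      linear_combination e1
    rw [e4, abs_le]
    have e5 := mul_nonneg (Nat.cast_nonneg (α := ℝ) s₁.card) e2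
    have e6 := mul_nonneg (Nat.cast_nonneg (α := ℝ) s₀.card) e3
    constructor <;> linarith
  have hpi := m.integrable_prob ν M a
  have hone : Integrable (fun _ : m.Λ => (1 : ℝ)) ν := integrable_const _
  have hI : Integrable (fun l => 1 - ∑ i ∈ s, q i l) ν := hone.sub (hsi s)
  have hI₀ : Integrable (fun l => ∑ i ∈ s, q i l - ∑ i ∈ s₀, q i l) ν := (hsi s).sub (hsi s₀)
  have hI₁ : Integrable (fun l => 1 - ∑ i ∈ s, q i l - ∑ i ∈ s₁, q i l) ν := hI.sub (hsi s₁)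
  calc ∫ l, |(s₁.card : ℝ) * m.prob M a l - s₀.card * (1 - m.prob M a l)| ∂ν
      ≤ ∫ l, (s₁.card * (∑ i ∈ s, q i l - ∑ i ∈ s₀, q i l) +
          s₀.card * (1 - ∑ i ∈ s, q i l - ∑ i ∈ s₁, q i l)) ∂ν :=
        integral_mono_ae ((hpi.const_mul _).sub ((hone.sub hpi).const_mul _)).abs
          ((hI₀.const_mul _).add (hI₁.const_mul _)) hpt
    _ = _ := by
        rw [integral_add (hI₀.const_mul _) (hI₁.const_mul _), integral_const_mul,
          integral_const_mul, integral_sub (hsi s) (hsi s₀), integral_sub hI (hsi s₁),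
          integral_sub hone (hsi s)]
        simp [hsint]

end Cells

theorem orthonormal_tmul_basis {H ι : Type} [NormedAddCommGroup H] [InnerProductSpace ℂ H]
    {D : Type} [NormedAddCommGroup D] [InnerProductSpace ℂ D] {h : ι → H} (hh : ∀ i, ‖h i‖ = 1)
    {d : ι → D} (hd : Orthonormal ℂ d) : Orthonormal ℂ fun i => h i ⊗ₜ[ℂ] d i := by
  refine ⟨fun i => by rw [TensorProduct.norm_tmul, hh, hd.1, one_mul], fun i j hij => ?_⟩
  exact (TensorProduct.inner_tmul ..).trans (by rw [hd.2 hij, mul_zero])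

/-! ### Appending ancillas, evolving, and estimating the mean deviation. -/

namespace CompleteOnticModel

variable {C : CompleteOnticModel.{u, v, w}} {H : Type} [NormedAddCommGroup H]
  [InnerProductSpace ℂ H] [FiniteDimensional ℂ H]

/-- One ancilla step: the probability on the small system is a kernel average of that on the joint
one. The means therefore agree, and the deviation from a constant does not decrease. -/
theorem AncillaIndependence.exists_first (hAI : C.AncillaIndependence) {E : Type}
    [NormedAddCommGroup E] [InnerProductSpace ℂ E] [FiniteDimensional ℂ E] (s : C.Sys H)
    (t : C.Sys E) (st : C.Sys (H ⊗[ℂ] E)) (P : (C.system s).Prep) (M : (C.system s).Meas)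
    {f : E} (hf : ‖f‖ = 1) :
    ∃ P' : (C.system st).Prep, ∃ M' ∈ (C.localMeas st).first,
      ((C.system st).state P').op = embedState (tmulIsometry f hf) ((C.system s).state P).op ∧
      ((C.system st).obs M').op = TensorProduct.map ((C.system s).obs M).op LinearMap.id ∧
      (∀ a, ∫ l, (C.model st).prob M' a l ∂((C.model st).μ P') =
        ∫ l, (C.model s).prob M a l ∂((C.model s).μ P)) ∧
      ∀ a w, ∫ l, |(C.model s).prob M a l - w| ∂((C.model s).μ P) ≤
        ∫ l, |(C.model st).prob M' a l - w| ∂((C.model st).μ P') := by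
  obtain ⟨Q, hQ⟩ := (C.system t).state_surjective (DensityOperator.pure f hf)
  obtain ⟨P', hμ, hstate⟩ := C.exists_prep_append s t st P Q
  obtain ⟨M', hM', hop, hprob⟩ := hAI H E s t st M
  have : IsMarkovKernel (C.append s t st Q) := C.isMarkovKernel_append s t st Q
  refine ⟨P', M', hM', ?_, hop, fun a => ?_, fun a w => ?_⟩
  · rw [hstate, hQ]
    exact map_pure_eq_embedState f hf _
  · rw [hμ, integral_bind_of_bounded _ _ ((C.model st).measurable_prob M' a) (c := 1)]
    · simp_rw [hprob Q a]
    · intro l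
      rw [abs_of_nonneg ((C.model st).prob_nonneg M' a l)]
      exact (C.model st).prob_le_one M' a l
  · rw [hμ]
    exact integral_abs_sub_le_of_average _ _ ((C.model s).measurable_prob M a)
      ((C.model st).measurable_prob M' a) ((C.model s).prob_nonneg M a)
      ((C.model s).prob_le_one M a) ((C.model st).prob_nonneg M' a)
      ((C.model st).prob_le_one M' a) (.of_forall (hprob Q a)) w

/-- The deviation is carried through two ancilla steps and a unitary to the state with Schmidt
vector `∑ αᵢ gᵢ ⊗ dᵢ`, where the cell count applies. The last term on the right measures how far the
numbers of cells are from the ratio `w : 1 - w`. -/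
theorem card_mul_integral_abs_sub_le (hAI : C.AncillaIndependence) (hUI : C.UnitaryInvariance)
    (hPI : C.ParameterIndependence) (s : C.Sys H) (P : (C.system s).Prep)
    (M : (C.system s).Meas) (a : ℝ) {e₁ e₀ : H} (he₁ : ‖e₁‖ = 1) (he₀ : ‖e₀‖ = 1)
    (hp₁ : ((C.system s).obs M).proj a e₁ = e₁) (hp₀ : ((C.system s).obs M).proj a e₀ = 0)
    {ι : Type} [Fintype ι] [Nonempty ι] {α : ι → ℝ} (hα1 : ∑ i, α i ^ 2 = 1)
    {t t₀ t₁ : Finset ι} (h₀ : t₀ ⊆ t) (h₁ : Disjoint t t₁)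
    (hα : ∀ i ∈ t₀, ∀ j ∈ t₁, α i = α j) {w : ℝ}
    (hw : bornProb ((C.system s).state P).op ((C.system s).obs M) a = w)
    (hαw : ∑ i ∈ t, α i ^ 2 = w) :
    ((t₀.card : ℝ) + t₁.card) * ∫ l, |(C.model s).prob M a l - w| ∂((C.model s).μ P) ≤
      t₁.card * (w - ∑ i ∈ t₀, α i ^ 2) + t₀.card * (1 - w - ∑ i ∈ t₁, α i ^ 2) +
        |t₁.card * w - t₀.card * (1 - w)| := by
  classical
  have : Nontrivial H := nontrivial_of_norm_eq_one he₁
  let D := EuclideanSpace ℂ ι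
  let d : OrthonormalBasis ι ℂ D := EuclideanSpace.basisFun ι ℂ
  obtain ⟨i₀⟩ := ‹Nonempty ι›
  have hf := d.orthonormal.1 i₀
  have : Nontrivial D := nontrivial_of_norm_eq_one hf
  have : Nontrivial (H ⊗[ℂ] D) := nontrivial_tensorProduct
  have : Nontrivial (D ⊗[ℂ] H) := nontrivial_tensorProduct
  have : Nontrivial ((H ⊗[ℂ] D) ⊗[ℂ] (D ⊗[ℂ] H)) := nontrivial_tensorProduct
  obtain ⟨sD⟩ := C.nonempty_sys D
  obtain ⟨sG⟩ := C.nonempty_sys (H ⊗[ℂ] D)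
  obtain ⟨sR⟩ := C.nonempty_sys (D ⊗[ℂ] H)
  obtain ⟨sV⟩ := C.nonempty_sys ((H ⊗[ℂ] D) ⊗[ℂ] (D ⊗[ℂ] H))
  have hk : ‖d i₀ ⊗ₜ[ℂ] e₁‖ = 1 := by rw [TensorProduct.norm_tmul, hf, he₁, one_mul]
  obtain ⟨P₁, M₁, -, hst₁, hop₁, hint₁, hle₁⟩ := hAI.exists_first s sD sG P M hf
  obtain ⟨P₂, M₂, hM₂, hst₂, hop₂, hint₂, hle₂⟩ := hAI.exists_first sG sR sV P₁ M₁ hk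
  -- The factor `d i` makes the family orthonormal, while `e₁` or `e₀` decides on which side of the
  -- eigenspace of `A ⊗ 1` the vector lies. So one vector of each kind in `H` suffices for any
  -- number of cells.
  let g : ι → H ⊗[ℂ] D := fun i => (if i ∈ t then e₁ else e₀) ⊗ₜ[ℂ] d i
  have hg : Orthonormal ℂ g :=
    orthonormal_tmul_basis (fun i => by split_ifs <;> assumption) d.orthonormal
  let Ψ := schmidtVector g d α
  have hΨ : ‖Ψ‖ = 1 := norm_schmidtVector hg d.orthonormal hα1
  -- The unitary sends `(h ⊗ f) ⊗ k` to `Ψ ⊗ h`, reassociated, where `f` and `k` are the fixed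
  -- ancilla vectors: the original state moves to the far side.
  obtain ⟨U, hU⟩ := exists_unitary_comp_eq (V := (H ⊗[ℂ] D) ⊗[ℂ] (D ⊗[ℂ] H))
    ((tmulIsometry _ hk).comp (tmulIsometry _ hf)) (tensorIsometry (H := H) Ψ hΨ)
  obtain ⟨T, hT⟩ := (C.system sV).unitary_surjective U
  have hev : evolve ((C.system sV).unitary T) ((C.system sV).state P₂).op =
      embedState (V := (H ⊗[ℂ] D) ⊗[ℂ] (D ⊗[ℂ] H)) (tensorIsometry Ψ hΨ)
        ((C.system s).state P).op := by
    rw [hT, hst₂, hst₁, embedState_embedState]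
    exact evolve_embedState _ _ U hU _
  set σ := evolve ((C.system sV).unitary T) ((C.system sV).state P₂).op
  have hσ : ∀ (x : H ⊗[ℂ] D →ₗ[ℂ] H ⊗[ℂ] D) (y : D →ₗ[ℂ] D),
      LinearMap.trace ℂ ((H ⊗[ℂ] D) ⊗[ℂ] (D ⊗[ℂ] H))
        (σ ∘ₗ TensorProduct.map x (TensorProduct.map y LinearMap.id)) =
        inner ℂ Ψ (TensorProduct.map x y Ψ) := by
    intro x y
    have h := trace_embedState_tensorIsometry Ψ hΨ ((C.system s).state P).op x y
    rw [((C.system s).state P).trace_eq_one, mul_one, ← hev] at h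
    exact h
  have hproj : ((C.system sG).obs M₁).proj a =
      TensorProduct.map (((C.system s).obs M).proj a) LinearMap.id :=
    Observable.proj_of_op_eq_map_id hop₁ a
  have hgt : ∀ i ∈ t, ((C.system sG).obs M₁).proj a (g i) = g i := by
    intro i hi
    rw [hproj]
    simp only [g, if_pos hi]
    rw [TensorProduct.map_tmul, hp₁, LinearMap.id_apply]
  have hgt' : ∀ i ∉ t, ((C.system sG).obs M₁).proj a (g i) = 0 := by
    intro i hi
    rw [hproj]
    simp only [g, if_neg hi]
    rw [TensorProduct.map_tmul, hp₀, TensorProduct.zero_tmul]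
  have ha₁ : ((C.system sG).obs M₁).proj a ≠ 0 := by
    rw [hproj]
    refine TensorProduct.map_ne_zero (fun h => ?_) linearMap_id_ne_zero
    rw [h, LinearMap.zero_apply] at hp₁
    simp [← hp₁] at he₁
  have ha₂ : a ∈ ((C.system sV).obs M₂).outcomes :=
    LocalMeasurements.mem_outcomes_first hop₂ ha₁
  have hσborn : bornProb σ ((C.system sV).obs M₂) a = w := by
    have h := hσ (((C.system sG).obs M₁).proj a) LinearMap.id
    rw [inner_map_left_schmidtVector hg d.orthonormal t hgt hgt', hαw, TensorProduct.map_id] at h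
    rw [bornProb, Observable.proj_of_op_eq_map_id hop₂]
    exact (congrArg Complex.re h).trans (Complex.ofReal_re w)
  -- Appending ancillas preserves the mean of the response, so the Born probability before the
  -- evolution needs no trace computation. With `hσborn` it yields the hypothesis of unitary
  -- invariance.
  have hborn : bornProb ((C.system sV).state P₂).op ((C.system sV).obs M₂) a = w := by
    rw [← (C.model sV).reproducesBorn_μ P₂ M₂ a, hint₂, hint₁,
      (C.model s).reproducesBorn_μ P M a, hw]
  have hinv := hUI _ sV P₂ T M₂ a (hborn.trans hσborn.symm)
  set ν := ((C.model sV).μ P₂).bind ((C.model sV).γ T)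
  have hν : (C.model sV).ReproducesBorn ν σ := (C.model sV).reproducesBorn_bind P₂ T
  have hle₃ : ∫ l, |(C.model sV).prob M₂ a l - w| ∂((C.model sV).μ P₂) ≤
      ∫ l, |(C.model sV).prob M₂ a l - w| ∂ν :=
    integral_abs_sub_le_of_average _ _ ((C.model sV).measurable_prob M₂ a)
      ((C.model sV).measurable_prob M₂ a) ((C.model sV).prob_nonneg M₂ a)
      ((C.model sV).prob_le_one M₂ a) ((C.model sV).prob_nonneg M₂ a)
      ((C.model sV).prob_le_one M₂ a) hinv w
  have hcells := (hPI _ _ sV).integral_abs_cells_le hν hg d hσ hM₂ hop₂ ha₂ hgt hgt' h₀ h₁ hα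
  rw [hαw] at hcells
  have hpi := (C.model sV).integrable_prob ν M₂ a
  have hi : Integrable (fun l => |(t₁.card : ℝ) * (C.model sV).prob M₂ a l -
      t₀.card * (1 - (C.model sV).prob M₂ a l)|) ν :=
    ((hpi.const_mul _).sub (((integrable_const 1).sub hpi).const_mul _)).abs
  calc ((t₀.card : ℝ) + t₁.card) * ∫ l, |(C.model s).prob M a l - w| ∂((C.model s).μ P)
      ≤ (t₀.card + t₁.card) * ∫ l, |(C.model sV).prob M₂ a l - w| ∂ν :=
        mul_le_mul_of_nonneg_left (((hle₁ a w).trans (hle₂ a w)).trans hle₃) (by positivity)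
    _ = ∫ l, (t₀.card + t₁.card) * |(C.model sV).prob M₂ a l - w| ∂ν :=
        (integral_const_mul _ _).symm
    _ ≤ ∫ l, (|(t₁.card : ℝ) * (C.model sV).prob M₂ a l -
          t₀.card * (1 - (C.model sV).prob M₂ a l)| +
            |t₁.card * w - t₀.card * (1 - w)|) ∂ν := by
        refine integral_mono ((hpi.sub (integrable_const w)).abs.const_mul _)
          (hi.add (integrable_const _)) fun l => ?_
        have hc : (0 : ℝ) ≤ t₀.card + t₁.card := by positivity
        change ((t₀.card : ℝ) + t₁.card) * |(C.model sV).prob M₂ a l - w| ≤ _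
        rw [← abs_of_nonneg hc, ← abs_mul]
        -- The expression `c₁ p - c₀ (1 - p)` is affine in `p` with slope `c₀ + c₁`; its values at
        -- the response and at `w` are subtracted.
        refine le_trans (le_of_eq ?_) (abs_sub _ _)
        congr 1
        ring
    _ = ∫ l, |(t₁.card : ℝ) * (C.model sV).prob M₂ a l -
          t₀.card * (1 - (C.model sV).prob M₂ a l)| ∂ν + |t₁.card * w - t₀.card * (1 - w)| := by
        rw [integral_add hi (integrable_const _)]
        simp
    _ ≤ _ := by gcongr

/-- The cells of weight `1 / n` on both sides, together with one remainder on each side. -/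
theorem mul_integral_abs_sub_le (hAI : C.AncillaIndependence) (hUI : C.UnitaryInvariance)
    (hPI : C.ParameterIndependence) (s : C.Sys H) (P : (C.system s).Prep)
    (M : (C.system s).Meas) (a : ℝ) {e₁ e₀ : H} (he₁ : ‖e₁‖ = 1) (he₀ : ‖e₀‖ = 1)
    (hp₁ : ((C.system s).obs M).proj a e₁ = e₁) (hp₀ : ((C.system s).obs M).proj a e₀ = 0)
    {w : ℝ} (hw : bornProb ((C.system s).state P).op ((C.system s).obs M) a = w)
    (hw0 : 0 ≤ w) (hw1 : w ≤ 1) {n : ℕ} (hn : 0 < n) :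
    ((n : ℝ) - 2) * ∫ l, |(C.model s).prob M a l - w| ∂((C.model s).μ P) ≤ 2 := by
  classical
  have hn' : (0 : ℝ) < n := Nat.cast_pos.2 hn
  -- The numbers of full cells of weight `1 / n` inside the eigenspace and in its complement.
  -- Rounding down loses less than one cell on each side, so `p + q > n - 2`.
  set p := ⌊n * w⌋₊
  set q := ⌊n * (1 - w)⌋₊
  have hp1 : (p : ℝ) ≤ n * w := Nat.floor_le (by positivity)
  have hq1 : (q : ℝ) ≤ n * (1 - w) := Nat.floor_le (mul_nonneg hn'.le (by linarith))
  have hp2 : n * w < p + 1 := Nat.lt_floor_add_one _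
  have hq2 : n * (1 - w) < q + 1 := Nat.lt_floor_add_one _
  -- In each summand `none` indexes the remainder, which may have weight zero.
  let ι := Option (Fin p) ⊕ Option (Fin q)
  have hr₁ : 0 ≤ w - p / n := by
    rw [sub_nonneg, div_le_iff₀ hn']; linarith
  have hr₀ : 0 ≤ 1 - w - q / n := by
    rw [sub_nonneg, div_le_iff₀ hn']; linarith
  let α : ι → ℝ := Sum.elim
    (fun i => i.elim (√(w - p / n)) fun _ => √(1 / n))
    (fun i => i.elim (√(1 - w - q / n)) fun _ => √(1 / n))
  let t : Finset ι := Finset.univ.map Function.Embedding.inl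
  let t₀ : Finset ι := Finset.univ.map
    ((Function.Embedding.some (α := Fin p)).trans Function.Embedding.inl)
  let t₁ : Finset ι := Finset.univ.map
    ((Function.Embedding.some (α := Fin q)).trans Function.Embedding.inr)
  have hsq : √(1 / (n : ℝ)) ^ 2 = 1 / n := Real.sq_sqrt (by positivity)
  have hαt : ∑ i ∈ t, α i ^ 2 = w := by
    refine (Finset.sum_map _ _ _).trans ?_
    change ∑ i : Option (Fin p), (i.elim (√(w - p / n)) fun _ => √(1 / n)) ^ 2 = w
    simp only [Fintype.sum_option, Option.elim, Real.sq_sqrt hr₁, hsq, Finset.sum_const,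
      Finset.card_univ, Fintype.card_fin, nsmul_eq_mul]
    ring
  have hα1 : ∑ i, α i ^ 2 = 1 := by
    simp only [ι, α, Fintype.sum_sum_type, Sum.elim_inl, Sum.elim_inr,
      Fintype.sum_option, Option.elim, Real.sq_sqrt hr₁, Real.sq_sqrt hr₀, hsq, Finset.sum_const,
      Finset.card_univ, Fintype.card_fin, nsmul_eq_mul]
    ring
  have hαt₀ : ∑ i ∈ t₀, α i ^ 2 = p / n := by
    refine (Finset.sum_map _ _ _).trans ?_
    change ∑ _i : Fin p, √(1 / (n : ℝ)) ^ 2 = p / n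
    simp [div_eq_mul_inv]
  have hαt₁ : ∑ i ∈ t₁, α i ^ 2 = q / n := by
    refine (Finset.sum_map _ _ _).trans ?_
    change ∑ _i : Fin q, √(1 / (n : ℝ)) ^ 2 = q / n
    simp [div_eq_mul_inv]
  have h := card_mul_integral_abs_sub_le hAI hUI hPI s P M a he₁ he₀ hp₁ hp₀ hα1
    (t := t) (t₀ := t₀) (t₁ := t₁)
    (fun i hi => by
      obtain ⟨j, -, rfl⟩ := Finset.mem_map.1 hi
      exact Finset.mem_map.2 ⟨some j, Finset.mem_univ _, rfl⟩)
    (Finset.disjoint_left.2 fun i hi hi' => by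
      obtain ⟨j, -, rfl⟩ := Finset.mem_map.1 hi
      obtain ⟨k, -, hk⟩ := Finset.mem_map.1 hi'
      cases hk)
    (fun i hi j hj => by
      obtain ⟨i, -, rfl⟩ := Finset.mem_map.1 hi
      obtain ⟨j, -, rfl⟩ := Finset.mem_map.1 hj
      rfl) hw hαt
  have hc₀ : t₀.card = p := by simp [t₀]
  have hc₁ : t₁.card = q := by simp [t₁]
  rw [hαt₀, hαt₁, hc₀, hc₁] at h
  have hX : 0 ≤ ∫ l, |(C.model s).prob M a l - w| ∂((C.model s).μ P) :=
    integral_nonneg fun l => abs_nonneg _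
  have hb1 : w - p / n ≤ 1 / n := by
    rw [sub_le_iff_le_add, ← add_div, le_div_iff₀ hn']; linarith
  have hb0 : 1 - w - q / n ≤ 1 / n := by
    rw [sub_le_iff_le_add, ← add_div, le_div_iff₀ hn']; linarith
  have hb : (q : ℝ) * (w - p / n) + p * (1 - w - q / n) ≤ 1 := by
    calc (q : ℝ) * (w - p / n) + p * (1 - w - q / n) ≤ q * (1 / n) + p * (1 / n) := by gcongr
      _ = (q + p) / n := by ring
      _ ≤ 1 := by rw [div_le_one hn']; linarith
  -- Without rounding both products would be `n * w * (1 - w)`; rounding lowers the first by at most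
  -- `w` and the second by at most `1 - w`.
  have hb' : |(q : ℝ) * w - p * (1 - w)| ≤ 1 := by
    rw [abs_le]
    constructor <;> nlinarith
  calc ((n : ℝ) - 2) * ∫ l, |(C.model s).prob M a l - w| ∂((C.model s).μ P)
      ≤ ((p : ℝ) + q) * ∫ l, |(C.model s).prob M a l - w| ∂((C.model s).μ P) :=
        mul_le_mul_of_nonneg_right (by linarith) hX
    _ ≤ 2 := by linarith

end CompleteOnticModel

end

/-! ### Degenerate outcomes, and the limit of infinitely many cells. -/

theorem theorem3 (C : CompleteOnticModel.{u, v, w})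
    (hAI : C.AncillaIndependence)
    (hUI : C.UnitaryInvariance)
    (hPI : C.ParameterIndependence)
    (H : Type) [NormedAddCommGroup H] [InnerProductSpace ℂ H] [FiniteDimensional ℂ H]
    (s : C.Sys H) :
    (C.model s).IsPsiComplete := by
  intro P _ M _ a
  set m := C.model s
  set A := (C.system s).obs M
  set w := bornProb ((C.system s).state P).op A a with hw
  have hwint : ∫ l, m.prob M a l ∂(m.μ P) = w := m.reproducesBorn_μ P M a
  have hpi := m.integrable_prob (m.μ P) M a
  have hw0 : 0 ≤ w := hwint ▸ integral_nonneg fun l => m.prob_nonneg M a l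
  have hw1 : w ≤ 1 := by
    rw [← hwint]
    refine (integral_mono hpi (integrable_const 1) fun l => m.prob_le_one M a l).trans_eq ?_
    simp
  -- The cells need unit vectors both in the eigenspace and orthogonal to it. If there is none of
  -- the first kind, the projection is zero and `w = 0`; if none of the second, it is the identity
  -- and `w = 1`. In both cases a response between 0 and 1 with such a mean is almost surely
  -- constant.
  by_cases hA0 : ∀ e : H, ‖e‖ = 1 → A.proj a e ≠ e
  · have hz : w = 0 := by
      have h0 : A.proj a = 0 := by
        ext x
        by_contra hx
        change A.proj a x ≠ 0 at hx
        refine hA0 _ (norm_smul_inv_norm (𝕜 := ℂ) hx) ?_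
        rw [map_smul, A.proj_proj_apply]
      rw [hw, bornProb, h0]
      simp
    have h := (integral_eq_zero_iff_of_nonneg (fun l => m.prob_nonneg M a l) hpi).1
      (hwint.trans hz)
    filter_upwards [h] with l hl
    rw [hl, hz]; rfl
  by_cases hA1 : ∀ e : H, ‖e‖ = 1 → A.proj a e ≠ 0
  · have hz : w = 1 := by
      have h0 : A.proj a = LinearMap.id := by
        ext x
        by_contra hx
        have hx' : A.proj a x - x ≠ 0 := sub_ne_zero.2 hx
        refine hA1 _ (norm_smul_inv_norm (𝕜 := ℂ) hx') ?_
        rw [map_smul, map_sub, A.proj_proj_apply, sub_self, smul_zero]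
      rw [hw, bornProb, h0, LinearMap.comp_id, ((C.system s).state P).trace_eq_one]
      simp
    have hi : ∫ l, (1 - m.prob M a l) ∂(m.μ P) = 0 := by
      rw [integral_sub (integrable_const 1) hpi, hwint, hz]
      simp
    have h := (integral_eq_zero_iff_of_nonneg
      (fun l => sub_nonneg.2 (m.prob_le_one M a l)) ((integrable_const 1).sub hpi)).1 hi
    filter_upwards [h] with l hl
    rw [hz]
    exact (sub_eq_zero.1 hl).symm
  push Not at hA0 hA1
  obtain ⟨e₁, he₁, hp₁⟩ := hA0
  obtain ⟨e₀, he₀, hp₀⟩ := hA1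
  have hX : 0 ≤ ∫ l, |m.prob M a l - w| ∂(m.μ P) := integral_nonneg fun l => abs_nonneg _
  have hX0 : ∫ l, |m.prob M a l - w| ∂(m.μ P) = 0 := by
    by_contra hne
    have hpos := lt_of_le_of_ne hX (Ne.symm hne)
    -- A positive deviation `X` would violate `(n - 2) * X ≤ 2` as soon as `n > 2 / X + 2`.
    obtain ⟨n, hn⟩ := exists_nat_gt (2 / (∫ l, |m.prob M a l - w| ∂(m.μ P)) + 2)
    have hn0 : 0 < n := by
      have : (0 : ℝ) < n := lt_trans (by positivity) hn
      exact_mod_cast this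
    have h := CompleteOnticModel.mul_integral_abs_sub_le hAI hUI hPI s P M a he₁ he₀ hp₁ hp₀
      hw.symm hw0 hw1 hn0
    have h2 : 2 / (∫ l, |m.prob M a l - w| ∂(m.μ P)) < (n : ℝ) - 2 := by linarith
    rw [div_lt_iff₀ hpos] at h2
    exact absurd h (not_le.2 h2)
  filter_upwards [(integral_eq_zero_iff_of_nonneg (fun l => abs_nonneg _)
    (hpi.sub (integrable_const w)).abs).1 hX0] with l hl
  exact sub_eq_zero.1 (abs_eq_zero.1 hl)
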